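/- Let $\mathcal G$ be a first-order structure. Let $G$ be a group acting by automorphisms on an abelian group $A$, where $G$, $A$ and the action are $\emptyset$-definable in $\mathcal G$. Let $B\subset\mathcal G$ be a finite set and let $h\colon G\times G\to A$ be a $B$-definable 2-cocycle, i.e. $$h(g_1,g_2)+h(g_1g_2,g_3)=h(g_1,g_2g_3)+g_1\cdot h(g_2,g_3),\qquad h(g,e)=h(e,g)=0,$$ whose image is finite and contained in $\operatorname{dcl}(B)$. Let $\widetilde G$ be the set $A\times G$ with the group law $(a_1,g_1)(a_2,g_2)=(a_1+g_1\cdot a_2+h(g_1,g_2),\,g_1g_2)$, and identify $A$ with $A\times\{e\}$. Let $\mathcal G^*\succ\mathcal G$ be a monster model, that is, a $\kappa$-saturated and strongly $\kappa$-homogeneous elementary extension, where $\kappa>2^{|L|+\aleph_0}$ and $L$ is the language of $\mathcal G$; an index is called bounded if it is less than $\kappa$. Let $G^*$, $A^*$, $\widetilde{G^*}$ be the interpretations of $G$, $A$, $\widetilde G$ in $\mathcal G^*$. For $\Gamma=G^*$ or $\Gamma=\widetilde{G^*}$, let $\Gamma^{000}_B$ be the smallest subgroup of $\Gamma$ of bounded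 index which is invariant under $\operatorname{Aut}(\mathcal G^*/B)$, and let $\Gamma^{00}_B$ be the smallest subgroup of $\Gamma$ of bounded index which is type-definable over $B$ (in each case, the intersection of all such subgroups). Suppose that ${G^*}^{000}_B={G^*}^{00}_B$. Then the subgroup $\widetilde{G^*}^{000}_B$ of $\widetilde{G^*}^{00}_B$ is normal in it, and there is a group isomorphism $$\Phi\colon\ \widetilde{G^*}^{00}_B/\widetilde{G^*}^{000}_B\ \longrightarrow\ \bigl(\widetilde{G^*}^{00}_B\cap A^*\bigr)/\bigl(\widetilde{G^*}^{000}_B\cap A^*\bigr)$$ which is $B$-invariant, i.e. the set of pairs $(x,a)\in\widetilde{G^*}^{00}_B\times(\widetilde{G^*}^{00}_B\cap A^*)$ such that $\Phi$ maps the coset of $x$ to the coset of $a$ is invariant under $\operatorname{Aut}(\mathcal G^*/B)$. In particular, $\widetilde{G^*}^{00}_B/\widetilde{G^*}^{000}_B$ is abelian. -/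

import Mathlib

universe u v w w'

namespace GroupExtComponents

section Extension

/-- A 2-cocycle (factor set) `h : G × G → A` for an action of a group `G` by automorphisms on an
abelian group `A`, normalized by `h(g, e) = h(e, g) = 0`. -/
structure TwoCocycle (G : Type*) (A : Type*) [Group G] [AddCommGroup A]
    [DistribMulAction G A] where
  /-- The underlying function of two variables. -/
  toFun : G → G → A
  cocycle' : ∀ g₁ g₂ g₃ : G,
    toFun g₁ g₂ + toFun (g₁ * g₂) g₃ = toFun g₁ (g₂ * g₃) + g₁ • toFun g₂ g₃
  map_one_right' : ∀ g : G, toFun g 1 = 0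
  map_one_left' : ∀ g : G, toFun 1 g = 0

/-- The set `A × G`, to be equipped with the group law twisted by the 2-cocycle `h`. -/
@[ext]
structure CocycleExtension {G : Type*} {A : Type*} [Group G] [AddCommGroup A]
    [DistribMulAction G A] (h : TwoCocycle G A) where
  /-- The coordinate in `A`. -/
  fst : A
  /-- The coordinate in `G`. -/
  snd : G

variable {G : Type*} {A : Type*} [Group G] [AddCommGroup A] [DistribMulAction G A]
  {h : TwoCocycle G A}

namespace CocycleExtension

/-- `(a₁, g₁) * (a₂, g₂) = (a₁ + g₁ • a₂ + h (g₁, g₂), g₁ g₂)`. -/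
instance : Mul (CocycleExtension h) :=
  ⟨fun x y => ⟨x.fst + x.snd • y.fst + h.toFun x.snd y.snd, x.snd * y.snd⟩⟩

instance : One (CocycleExtension h) := ⟨⟨0, 1⟩⟩

instance : Inv (CocycleExtension h) :=
  ⟨fun x => ⟨-(x.snd⁻¹ • x.fst) - h.toFun x.snd⁻¹ x.snd, x.snd⁻¹⟩⟩

theorem mul_def (x y : CocycleExtension h) :
    x * y = ⟨x.fst + x.snd • y.fst + h.toFun x.snd y.snd, x.snd * y.snd⟩ := rfl

theorem one_def : (1 : CocycleExtension h) = ⟨0, 1⟩ := rfl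

theorem inv_def (x : CocycleExtension h) :
    x⁻¹ = ⟨-(x.snd⁻¹ • x.fst) - h.toFun x.snd⁻¹ x.snd, x.snd⁻¹⟩ := rfl

instance : Group (CocycleExtension h) :=
  Group.ofLeftAxioms
    (by
      intro x y z
      ext
      · have hc := h.cocycle' x.snd y.snd z.snd
        simp only [mul_def, smul_add, mul_smul]
        have : h.toFun x.snd y.snd
            = h.toFun x.snd (y.snd * z.snd) + x.snd • h.toFun y.snd z.snd
              - h.toFun (x.snd * y.snd) z.snd := by
          rw [← hc]; abel
        rw [this]; abel
      · simp [mul_def, mul_assoc])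
    (by
      intro x
      ext
      · simp [mul_def, one_def, h.map_one_left']
      · simp [mul_def, one_def])
    (by
      intro x
      ext
      · simp only [mul_def, one_def, inv_def]; abel
      · simp [mul_def, one_def, inv_def])

end CocycleExtension

/-- `H ∩ A` for a subgroup `H` of the extension, where `A` is identified with the subgroup
`A × {e}` of the extension. -/
def interA (H : Subgroup (CocycleExtension h)) : AddSubgroup A where
  carrier := {a | (⟨a, 1⟩ : CocycleExtension h) ∈ H}
  zero_mem' := H.one_mem
  add_mem' := by
    intro a b ha hb
    have := H.mul_mem ha hb
    simpa [CocycleExtension.mul_def, h.map_one_left'] using this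
  neg_mem' := by
    intro a ha
    have := H.inv_mem ha
    simpa [CocycleExtension.inv_def, h.map_one_left'] using this

end Extension

section Interpretation

open FirstOrder FirstOrder.Language

variable {L : FirstOrder.Language.{u, v}} {M : Type w} {N : Type w'} [L.Structure M] [L.Structure N]

/-- The interpretation `S*` in an elementary extension `N` of a set `S` of tuples definable in `M`
(with parameters): the set of tuples of `N` satisfying a formula that defines `S` in `M`. By
elementarity it does not matter which formula is used. -/
def star (j : M ↪ₑ[L] N) {α : Type*} (S : Set (α → M)) : Set (α → N) :=
  {v | ∃ φ : L.Formula (M ⊕ α), (∀ t : α → M, t ∈ S ↔ φ.Realize (Sum.elim id t)) ∧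
    φ.Realize (Sum.elim j v)}

/-- The concatenation of three tuples. -/
def tuple₃ {K α β γ : Type*} (x : α → K) (y : β → K) (z : γ → K) : α ⊕ β ⊕ γ → K :=
  Sum.elim x (Sum.elim y z)

/-- The graph of a function of two variables between sets of tuples. -/
def graph₂ {K α β γ : Type*} {X : Set (α → K)} {Y : Set (β → K)} {Z : Set (γ → K)}
    (f : X → Y → Z) : Set (α ⊕ β ⊕ γ → K) :=
  {v | ∃ (x : X) (y : Y), v = tuple₃ x.1 y.1 (f x y).1}

theorem tuple₃_inj {K α β γ : Type*} {x x' : α → K} {y y' : β → K} {z z' : γ → K} :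
    tuple₃ x y z = tuple₃ x' y' z' ↔ x = x' ∧ y = y' ∧ z = z' := by
  constructor
  · intro e
    refine ⟨?_, ?_, ?_⟩
    · funext i; exact congrFun e (Sum.inl i)
    · funext i; exact congrFun e (Sum.inr (Sum.inl i))
    · funext i; exact congrFun e (Sum.inr (Sum.inr i))
  · rintro ⟨rfl, rfl, rfl⟩; rfl

theorem mem_graph₂ {K α β γ : Type*} {X : Set (α → K)} {Y : Set (β → K)} {Z : Set (γ → K)}
    (f : X → Y → Z) {x : α → K} {y : β → K} {z : γ → K} :
    tuple₃ x y z ∈ graph₂ f ↔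
      ∃ (hx : x ∈ X) (hy : y ∈ Y), (f ⟨x, hx⟩ ⟨y, hy⟩).1 = z := by
  constructor
  · rintro ⟨x', y', e⟩
    obtain ⟨rfl, rfl, rfl⟩ := tuple₃_inj.1 e
    exact ⟨x'.2, y'.2, rfl⟩
  · rintro ⟨hx, hy, rfl⟩
    exact ⟨⟨x, hx⟩, ⟨y, hy⟩, rfl⟩

theorem exists_formula {α : Type*} {C : Set M} {S : Set (α → M)} (hS : C.Definable L S) :
    ∃ φ : L.Formula (M ⊕ α), ∀ t : α → M, t ∈ S ↔ φ.Realize (Sum.elim id t) := by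
  obtain ⟨φ, hφ⟩ := Set.definable_iff_exists_formula_sum.1 hS
  refine ⟨φ.relabel (Sum.map (fun c : C => (c : M)) id), fun t => ?_⟩
  rw [Formula.realize_relabel, hφ, Sum.elim_comp_map]
  rfl

/-- `Trans j P Q` says that the first order property `Q` of tuples of `N` is given by a formula
which gives `P` in `M`. The tuples consist of blocks indexed by `α` and of blocks indexed
by `β`. -/
def Trans (j : M ↪ₑ[L] N) {k l : ℕ} {α β : Type*}
    (P : (Fin k → α → M) → (Fin l → β → M) → Prop)
    (Q : (Fin k → α → N) → (Fin l → β → N) → Prop) : Prop :=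
  ∃ φ : L.Formula (M ⊕ ((Fin k × α) ⊕ (Fin l × β))),
    (∀ p q, P p q ↔ φ.Realize (Sum.elim id (Sum.elim (fun i => p i.1 i.2) (fun i => q i.1 i.2)))) ∧
    (∀ p q, Q p q ↔ φ.Realize (Sum.elim j (Sum.elim (fun i => p i.1 i.2) (fun i => q i.1 i.2))))

section Trans

variable {j : M ↪ₑ[L] N} {k l : ℕ} {α β : Type*}
  {P P' : (Fin k → α → M) → (Fin l → β → M) → Prop}
  {Q Q' : (Fin k → α → N) → (Fin l → β → N) → Prop}

theorem realize_all {τ : Type*} [Finite τ] (φ : L.Formula (M ⊕ τ))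
    (hφ : ∀ t : τ → M, φ.Realize (Sum.elim id t)) (v : τ → N) : φ.Realize (Sum.elim j v) := by
  have h1 : (φ.iAlls τ).Realize (id : M → M) := Formula.realize_iAlls.2 hφ
  have h2 := (j.map_formula (φ.iAlls τ) id).2 h1
  exact Formula.realize_iAlls.1 h2 v

theorem Trans.all [Finite α] [Finite β] (h : Trans j P Q) (hP : ∀ p q, P p q) (p q) : Q p q := by
  obtain ⟨φ, h1, h2⟩ := h
  rw [h2]
  refine realize_all φ (fun t => ?_) _
  have := (h1 (fun i a => t (Sum.inl (i, a))) (fun i b => t (Sum.inr (i, b)))).1 (hP _ _)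
  convert! this using 2
  funext i
  rcases i with ⟨i, a⟩ | ⟨i, b⟩ <;> rfl

theorem Trans.and (h : Trans j P Q) (h' : Trans j P' Q') :
    Trans j (fun p q => P p q ∧ P' p q) (fun p q => Q p q ∧ Q' p q) := by
  obtain ⟨φ, h1, h2⟩ := h
  obtain ⟨ψ, h3, h4⟩ := h'
  exact ⟨φ ⊓ ψ, fun p q => by beta_reduce; rw [h1, h3, Formula.realize_inf],
    fun p q => by beta_reduce; rw [h2, h4, Formula.realize_inf]⟩

theorem Trans.imp (h : Trans j P Q) (h' : Trans j P' Q') :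
    Trans j (fun p q => P p q → P' p q) (fun p q => Q p q → Q' p q) := by
  obtain ⟨φ, h1, h2⟩ := h
  obtain ⟨ψ, h3, h4⟩ := h'
  exact ⟨φ.imp ψ, fun p q => by beta_reduce; rw [h1, h3, Formula.realize_imp],
    fun p q => by beta_reduce; rw [h2, h4, Formula.realize_imp]⟩

theorem mem_star_iff {τ : Type*} [Finite τ] {S : Set (τ → M)} {φ : L.Formula (M ⊕ τ)}
    (hφ : ∀ t : τ → M, t ∈ S ↔ φ.Realize (Sum.elim id t)) (v : τ → N) :
    v ∈ star j S ↔ φ.Realize (Sum.elim j v) := by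
  constructor
  · rintro ⟨ψ, h1, h2⟩
    have := realize_all (j := j) (ψ.imp φ)
      (fun t => by rw [Formula.realize_imp, ← h1, ← hφ]; exact id) v
    exact Formula.realize_imp.1 this h2
  · intro h
    exact ⟨φ, hφ, h⟩

theorem Trans.mem {τ : Type*} [Finite τ] {C : Set M} {S : Set (τ → M)} (hS : C.Definable L S)
    (f : τ → (Fin k × α) ⊕ (Fin l × β)) :
    Trans j (fun p q => Sum.elim (fun i => p i.1 i.2) (fun i => q i.1 i.2) ∘ f ∈ S)
      (fun p q => Sum.elim (fun i => p i.1 i.2) (fun i => q i.1 i.2) ∘ f ∈ star j S) := by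
  obtain ⟨φ, hφ⟩ := exists_formula hS
  refine ⟨φ.relabel (Sum.map id f), fun p q => ?_, fun p q => ?_⟩
  · beta_reduce; rw [hφ, Formula.realize_relabel, Sum.elim_comp_map]; rfl
  · beta_reduce; rw [mem_star_iff hφ, Formula.realize_relabel, Sum.elim_comp_map]; rfl

theorem Trans.eq_coord (i i' : (Fin k × α) ⊕ (Fin l × β)) :
    Trans j
      (fun p q => Sum.elim (fun i => p i.1 i.2) (fun i => q i.1 i.2) i =
        Sum.elim (fun i => p i.1 i.2) (fun i => q i.1 i.2) i')
      (fun p q => Sum.elim (fun i => p i.1 i.2) (fun i => q i.1 i.2) i =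
        Sum.elim (fun i => p i.1 i.2) (fun i => q i.1 i.2) i') :=
  ⟨(Term.var (Sum.inr i)).equal (Term.var (Sum.inr i')),
    fun p q => by simp [Formula.realize_equal], fun p q => by simp [Formula.realize_equal]⟩

theorem star_map {τ : Type*} [Finite τ] {C : Set M} {S : Set (τ → M)} (hS : C.Definable L S)
    (t : τ → M) : j ∘ t ∈ star j S ↔ t ∈ S := by
  obtain ⟨φ, hφ⟩ := exists_formula hS
  rw [mem_star_iff hφ, hφ, ← j.map_formula φ]
  have : (j : M → N) ∘ Sum.elim id t = Sum.elim j (j ∘ t) := by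
    rw [Sum.comp_elim]; rfl
  rw [this]

end Trans

theorem realize_exists_formula {K c₀ α β γ : Type*} [L.Structure K] [Finite γ]
    (φX : L.Formula (c₀ ⊕ α)) (φY : L.Formula (c₀ ⊕ β)) (φZ : L.Formula (c₀ ⊕ γ))
    (φ : L.Formula (c₀ ⊕ (α ⊕ β ⊕ γ))) (c : c₀ → K) (t : α ⊕ β → K) :
    ((φX.relabel (Sum.map id Sum.inl : c₀ ⊕ α → c₀ ⊕ (α ⊕ β)) ⊓
        φY.relabel (Sum.map id Sum.inr : c₀ ⊕ β → c₀ ⊕ (α ⊕ β))).imp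
      ((φZ.relabel (Sum.map Sum.inl id : c₀ ⊕ γ → (c₀ ⊕ (α ⊕ β)) ⊕ γ) ⊓
        φ.relabel (Sum.elim (Sum.inl ∘ Sum.inl) (Sum.elim (Sum.inl ∘ Sum.inr ∘ Sum.inl)
          (Sum.elim (Sum.inl ∘ Sum.inr ∘ Sum.inr) Sum.inr)) :
            c₀ ⊕ (α ⊕ β ⊕ γ) → (c₀ ⊕ (α ⊕ β)) ⊕ γ)).iExs γ)).Realize (Sum.elim c t) ↔
      (φX.Realize (Sum.elim c (t ∘ Sum.inl)) → φY.Realize (Sum.elim c (t ∘ Sum.inr)) →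
        ∃ z : γ → K, φZ.Realize (Sum.elim c z) ∧
          φ.Realize (Sum.elim c (tuple₃ (t ∘ Sum.inl) (t ∘ Sum.inr) z))) := by
  simp only [Formula.realize_imp, Formula.realize_inf, Formula.realize_iExs,
    Formula.realize_relabel, and_imp]
  refine imp_congr (iff_of_eq ?_) (imp_congr (iff_of_eq ?_)
    (exists_congr fun z => and_congr (iff_of_eq ?_) (iff_of_eq ?_)))
  · congr 1; funext i; rcases i with i | i <;> rfl
  · congr 1; funext i; rcases i with i | i <;> rfl
  · congr 1; funext i; rcases i with i | i <;> rfl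
  · congr 1; funext i; rcases i with i | i | i | i <;> rfl

theorem exists_star {j : M ↪ₑ[L] N} {α β γ : Type*} [Finite α] [Finite β] [Finite γ]
    {C C₁ C₂ C₃ : Set M} {X : Set (α → M)} {Y : Set (β → M)} {Z : Set (γ → M)} {f : X → Y → Z}
    (hX : C₁.Definable L X) (hY : C₂.Definable L Y) (hZ : C₃.Definable L Z)
    (hf : C.Definable L (graph₂ f)) (x : star j X) (y : star j Y) :
    ∃ z : star j Z, tuple₃ x.1 y.1 z.1 ∈ star j (graph₂ f) := by
  obtain ⟨φX, hφX⟩ := exists_formula hX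
  obtain ⟨φY, hφY⟩ := exists_formula hY
  obtain ⟨φZ, hφZ⟩ := exists_formula hZ
  obtain ⟨φ, hφ⟩ := exists_formula hf
  have h1 := realize_all (j := j) _
    (fun t => (realize_exists_formula φX φY φZ φ id t).2 (by
      rw [← hφX, ← hφY]
      intro hx hy
      refine ⟨_, (hφZ _).1 (f ⟨_, hx⟩ ⟨_, hy⟩).2, (hφ _).1 ?_⟩
      rw [mem_graph₂]
      exact ⟨hx, hy, rfl⟩)) (Sum.elim x.1 y.1)
  obtain ⟨z, hz, hz'⟩ := (realize_exists_formula φX φY φZ φ _ _).1 h1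
    ((mem_star_iff hφX _).1 x.2) ((mem_star_iff hφY _).1 y.2)
  exact ⟨⟨z, (mem_star_iff hφZ _).2 hz⟩, (mem_star_iff hφ _).2 hz'⟩

theorem realize_unique_formula {K c₀ α β γ : Type*} [L.Structure K]
    (φ : L.Formula (c₀ ⊕ (α ⊕ β ⊕ γ))) (i : γ) (c : c₀ → K) (t : (α ⊕ β ⊕ γ) ⊕ γ → K) :
    ((φ.relabel (Sum.map id Sum.inl : c₀ ⊕ (α ⊕ β ⊕ γ) → c₀ ⊕ ((α ⊕ β ⊕ γ) ⊕ γ)) ⊓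
        φ.relabel (Sum.map id (Sum.elim (Sum.inl ∘ Sum.inl)
          (Sum.elim (Sum.inl ∘ Sum.inr ∘ Sum.inl) Sum.inr)) :
            c₀ ⊕ (α ⊕ β ⊕ γ) → c₀ ⊕ ((α ⊕ β ⊕ γ) ⊕ γ))).imp
        ((Term.var (Sum.inr (Sum.inl (Sum.inr (Sum.inr i))))).equal
          (Term.var (Sum.inr (Sum.inr i))))).Realize (Sum.elim c t) ↔
      (φ.Realize (Sum.elim c (tuple₃ (fun k => t (Sum.inl (Sum.inl k)))
          (fun k => t (Sum.inl (Sum.inr (Sum.inl k))))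
          (fun k => t (Sum.inl (Sum.inr (Sum.inr k)))))) →
        φ.Realize (Sum.elim c (tuple₃ (fun k => t (Sum.inl (Sum.inl k)))
          (fun k => t (Sum.inl (Sum.inr (Sum.inl k)))) (fun k => t (Sum.inr k)))) →
        t (Sum.inl (Sum.inr (Sum.inr i))) = t (Sum.inr i)) := by
  simp only [Formula.realize_imp, Formula.realize_inf, Formula.realize_equal,
    Formula.realize_relabel, and_imp]
  refine imp_congr (iff_of_eq ?_) (imp_congr (iff_of_eq ?_) Iff.rfl)
  · congr 1; funext i; rcases i with i | i | i | i <;> rfl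
  · congr 1; funext i; rcases i with i | i | i | i <;> rfl

theorem star_unique {j : M ↪ₑ[L] N} {α β γ : Type*} [Finite α] [Finite β] [Finite γ]
    {C : Set M} {X : Set (α → M)} {Y : Set (β → M)} {Z : Set (γ → M)} {f : X → Y → Z}
    (hf : C.Definable L (graph₂ f)) {x : α → N} {y : β → N} {z z' : γ → N}
    (h : tuple₃ x y z ∈ star j (graph₂ f)) (h' : tuple₃ x y z' ∈ star j (graph₂ f)) :
    z = z' := by
  obtain ⟨φ, hφ⟩ := exists_formula hf
  funext i
  have h1 := realize_all (j := j) _ (fun t => (realize_unique_formula φ i id t).2 (by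
    rw [← hφ, ← hφ, mem_graph₂, mem_graph₂]
    rintro ⟨hx, hy, h1⟩ ⟨hx', hy', h2⟩
    exact congrFun (h1.symm.trans h2) i)) (Sum.elim (tuple₃ x y z) z')
  exact (realize_unique_formula φ i _ _).1 h1 ((mem_star_iff hφ _).1 h) ((mem_star_iff hφ _).1 h')

/-- The interpretation `f* : X* → Y* → Z*` of a definable function `f : X → Y → Z`: the function
whose graph is the interpretation of the graph of `f`. -/
noncomputable def starMap (j : M ↪ₑ[L] N) {α β γ : Type*} [Finite α] [Finite β] [Finite γ]
    {C C₁ C₂ C₃ : Set M} {X : Set (α → M)} {Y : Set (β → M)} {Z : Set (γ → M)} (f : X → Y → Z)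
    (hX : C₁.Definable L X) (hY : C₂.Definable L Y) (hZ : C₃.Definable L Z)
    (hf : C.Definable L (graph₂ f)) (x : star j X) (y : star j Y) : star j Z :=
  (exists_star hX hY hZ hf x y).choose

theorem starMap_spec (j : M ↪ₑ[L] N) {α β γ : Type*} [Finite α] [Finite β] [Finite γ]
    {C C₁ C₂ C₃ : Set M} {X : Set (α → M)} {Y : Set (β → M)} {Z : Set (γ → M)} (f : X → Y → Z)
    (hX : C₁.Definable L X) (hY : C₂.Definable L Y) (hZ : C₃.Definable L Z)
    (hf : C.Definable L (graph₂ f)) (x : star j X) (y : star j Y) :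
    tuple₃ x.1 y.1 (starMap j f hX hY hZ hf x y).1 ∈ star j (graph₂ f) :=
  (exists_star hX hY hZ hf x y).choose_spec

theorem starMap_eq_iff (j : M ↪ₑ[L] N) {α β γ : Type*} [Finite α] [Finite β] [Finite γ]
    {C C₁ C₂ C₃ : Set M} {X : Set (α → M)} {Y : Set (β → M)} {Z : Set (γ → M)} (f : X → Y → Z)
    (hX : C₁.Definable L X) (hY : C₂.Definable L Y) (hZ : C₃.Definable L Z)
    (hf : C.Definable L (graph₂ f)) (x : star j X) (y : star j Y) (z : star j Z) :
    starMap j f hX hY hZ hf x y = z ↔ tuple₃ x.1 y.1 z.1 ∈ star j (graph₂ f) := by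
  constructor
  · rintro rfl
    exact starMap_spec j f hX hY hZ hf x y
  · intro h
    exact Subtype.ext (star_unique hf (starMap_spec j f hX hY hZ hf x y) h)

theorem Trans.mem₃ {j : M ↪ₑ[L] N} {k l : ℕ} {α β τ₁ τ₂ τ₃ : Type*} [Finite τ₁] [Finite τ₂]
    [Finite τ₃] {C : Set M} {S : Set (τ₁ ⊕ τ₂ ⊕ τ₃ → M)} (hS : C.Definable L S)
    (f₁ : τ₁ → (Fin k × α) ⊕ (Fin l × β)) (f₂ : τ₂ → (Fin k × α) ⊕ (Fin l × β))
    (f₃ : τ₃ → (Fin k × α) ⊕ (Fin l × β)) :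
    Trans j
      (fun p q => tuple₃ (Sum.elim (fun i => p i.1 i.2) (fun i => q i.1 i.2) ∘ f₁)
        (Sum.elim (fun i => p i.1 i.2) (fun i => q i.1 i.2) ∘ f₂)
        (Sum.elim (fun i => p i.1 i.2) (fun i => q i.1 i.2) ∘ f₃) ∈ S)
      (fun p q => tuple₃ (Sum.elim (fun i => p i.1 i.2) (fun i => q i.1 i.2) ∘ f₁)
        (Sum.elim (fun i => p i.1 i.2) (fun i => q i.1 i.2) ∘ f₂)
        (Sum.elim (fun i => p i.1 i.2) (fun i => q i.1 i.2) ∘ f₃) ∈ star j S) := by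
  have h := Trans.mem (j := j) hS (tuple₃ f₁ f₂ f₃)
  simp only [tuple₃, Sum.comp_elim] at h
  exact h

/-- The variables of a block of the first kind. -/
abbrev gv {k l : ℕ} {α β : Type*} (a : Fin k) : α → (Fin k × α) ⊕ (Fin l × β) :=
  fun i => Sum.inl (a, i)

/-- The variables of a block of the second kind. -/
abbrev av {k l : ℕ} {α β : Type*} (a : Fin l) : β → (Fin k × α) ⊕ (Fin l × β) :=
  fun i => Sum.inr (a, i)

end Interpretation

section Situation

open FirstOrder FirstOrder.Language

variable {L : FirstOrder.Language.{u, v}} {M : Type w} [L.Structure M]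

/-- The definable closure of a set of parameters. -/
def dcl (L : FirstOrder.Language.{u, v}) {M : Type w} [L.Structure M] (B : Set M) : Set M :=
  {b | B.Definable₁ L {b}}

/-- The basic situation: the group `G` (with underlying set a set of tuples of `M`), the abelian
group `A` and the action of `G` on `A` by automorphisms are definable without parameters in the
structure `M`, and the 2-cocycle `h` is definable over a finite set `B` of parameters from `M` and
has finite image, contained in the definable closure of `B`. -/
structure DefinableExtension (L : FirstOrder.Language.{u, v}) {M : Type w} [L.Structure M]
    (B : Set M) {m n : ℕ} (G : Set (Fin m → M)) (A : Set (Fin n → M)) [Group G]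
    [AddCommGroup A] [DistribMulAction G A] (h : TwoCocycle G A) : Prop where
  finite_B : B.Finite
  definable_G : (∅ : Set M).Definable L G
  definable_mul : (∅ : Set M).Definable L (graph₂ fun g₁ g₂ : G => g₁ * g₂)
  definable_A : (∅ : Set M).Definable L A
  definable_add : (∅ : Set M).Definable L (graph₂ fun a₁ a₂ : A => a₁ + a₂)
  definable_smul : (∅ : Set M).Definable L (graph₂ fun (g : G) (a : A) => g • a)
  definable_h : B.Definable L (graph₂ h.toFun)
  finite_image : (Set.range fun p : G × G => h.toFun p.1 p.2).Finite
  image_dcl : ∀ (g₁ g₂ : G) (i : Fin n), (h.toFun g₁ g₂).1 i ∈ dcl L B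

variable {B : Set M} {m n : ℕ} {G : Set (Fin m → M)} {A : Set (Fin n → M)} [Group G]
  [AddCommGroup A] [DistribMulAction G A] {h : TwoCocycle G A}
  {N : Type w'} [L.Structure N]

namespace DefinableExtension

/-- The interpretation `G*` of `G` in an elementary extension. -/
def GStar (_ : DefinableExtension L B G A h) (j : M ↪ₑ[L] N) : Type w' := ↥(star j G)

/-- The interpretation `A*` of `A` in an elementary extension. -/
def AStar (_ : DefinableExtension L B G A h) (j : M ↪ₑ[L] N) : Type w' := ↥(star j A)

variable (S : DefinableExtension L B G A h) (j : M ↪ₑ[L] N)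

/-- The tuple of elements of the structure that is a given element of `G*`. -/
def coordG (x : S.GStar j) : Fin m → N := x.1

/-- The tuple of elements of the structure that is a given element of `A*`. -/
def coordA (a : S.AStar j) : Fin n → N := a.1

theorem coordG_injective : Function.Injective (S.coordG j) := Subtype.val_injective

theorem coordA_injective : Function.Injective (S.coordA j) := Subtype.val_injective

/-- The multiplication of `G*` is the interpretation of the multiplication of `G`. -/
noncomputable instance : Mul (S.GStar j) :=
  ⟨starMap j (fun g₁ g₂ : G => g₁ * g₂) S.definable_G S.definable_G S.definable_G
    S.definable_mul⟩

/-- The addition of `A*` is the interpretation of the addition of `A`. -/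
noncomputable instance : Add (S.AStar j) :=
  ⟨starMap j (fun a₁ a₂ : A => a₁ + a₂) S.definable_A S.definable_A S.definable_A
    S.definable_add⟩

/-- The action of `G*` on `A*` is the interpretation of the action of `G` on `A`. -/
noncomputable instance : SMul (S.GStar j) (S.AStar j) :=
  ⟨starMap j (fun (g : G) (a : A) => g • a) S.definable_G S.definable_A S.definable_A
    S.definable_smul⟩

/-- The interpretation `h* : G* × G* → A*` of the 2-cocycle. -/
noncomputable def hFun : S.GStar j → S.GStar j → S.AStar j :=
  starMap j h.toFun S.definable_G S.definable_G S.definable_A S.definable_h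

theorem definable_ldiv (S : DefinableExtension L B G A h) :
    (∅ : Set M).Definable L (graph₂ fun g₁ g₂ : G => g₁⁻¹ * g₂) := by
  have h1 := S.definable_mul.preimage_comp
    (Sum.elim Sum.inl (Sum.elim (Sum.inr ∘ Sum.inr) (Sum.inr ∘ Sum.inl)) :
      Fin m ⊕ Fin m ⊕ Fin m → Fin m ⊕ Fin m ⊕ Fin m)
  convert! h1 using 1
  ext t
  obtain ⟨x, y, z, rfl⟩ : ∃ x y z, t = tuple₃ x y z :=
    ⟨t ∘ Sum.inl, t ∘ Sum.inr ∘ Sum.inl, t ∘ Sum.inr ∘ Sum.inr, by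
      funext i; rcases i with i | i | i <;> rfl⟩
  have h2 : tuple₃ x y z ∘ (Sum.elim Sum.inl (Sum.elim (Sum.inr ∘ Sum.inr)
      (Sum.inr ∘ Sum.inl)) : Fin m ⊕ Fin m ⊕ Fin m → Fin m ⊕ Fin m ⊕ Fin m) = tuple₃ x z y := by
    funext i; rcases i with i | i | i <;> rfl
  rw [Set.mem_preimage, h2, mem_graph₂, mem_graph₂]
  constructor
  · rintro ⟨hx, hy, rfl⟩
    exact ⟨hx, Subtype.coe_prop _, by simp⟩
  · rintro ⟨hx, hz, rfl⟩
    exact ⟨hx, Subtype.coe_prop _, by simp⟩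

theorem definable_sub (S : DefinableExtension L B G A h) :
    (∅ : Set M).Definable L (graph₂ fun a₁ a₂ : A => -a₁ + a₂) := by
  have h1 := S.definable_add.preimage_comp
    (Sum.elim Sum.inl (Sum.elim (Sum.inr ∘ Sum.inr) (Sum.inr ∘ Sum.inl)) :
      Fin n ⊕ Fin n ⊕ Fin n → Fin n ⊕ Fin n ⊕ Fin n)
  convert! h1 using 1
  ext t
  obtain ⟨x, y, z, rfl⟩ : ∃ x y z, t = tuple₃ x y z :=
    ⟨t ∘ Sum.inl, t ∘ Sum.inr ∘ Sum.inl, t ∘ Sum.inr ∘ Sum.inr, by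
      funext i; rcases i with i | i | i <;> rfl⟩
  have h2 : tuple₃ x y z ∘ (Sum.elim Sum.inl (Sum.elim (Sum.inr ∘ Sum.inr)
      (Sum.inr ∘ Sum.inl)) : Fin n ⊕ Fin n ⊕ Fin n → Fin n ⊕ Fin n ⊕ Fin n) = tuple₃ x z y := by
    funext i; rcases i with i | i | i <;> rfl
  rw [Set.mem_preimage, h2, mem_graph₂, mem_graph₂]
  constructor
  · rintro ⟨hx, hy, rfl⟩
    exact ⟨hx, Subtype.coe_prop _, by simp⟩
  · rintro ⟨hx, hz, rfl⟩
    exact ⟨hx, Subtype.coe_prop _, by simp⟩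

noncomputable instance : One (S.GStar j) :=
  ⟨⟨j ∘ (1 : G).1, (star_map S.definable_G _).2 (1 : G).2⟩⟩

noncomputable instance : Zero (S.AStar j) :=
  ⟨⟨j ∘ (0 : A).1, (star_map S.definable_A _).2 (0 : A).2⟩⟩

noncomputable instance : Inv (S.GStar j) :=
  ⟨fun x => starMap j (fun g₁ g₂ : G => g₁⁻¹ * g₂) S.definable_G S.definable_G S.definable_G
    S.definable_ldiv x (1 : S.GStar j)⟩

noncomputable instance : Neg (S.AStar j) :=
  ⟨fun x => starMap j (fun a₁ a₂ : A => -a₁ + a₂) S.definable_A S.definable_A S.definable_A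
    S.definable_sub x (0 : S.AStar j)⟩

theorem mul_spec (x y : S.GStar j) :
    tuple₃ x.1 y.1 (x * y).1 ∈ star j (graph₂ fun g₁ g₂ : G => g₁ * g₂) :=
  starMap_spec j (fun g₁ g₂ : G => g₁ * g₂) _ _ _ S.definable_mul x y

theorem add_spec (x y : S.AStar j) :
    tuple₃ x.1 y.1 (x + y).1 ∈ star j (graph₂ fun a₁ a₂ : A => a₁ + a₂) :=
  starMap_spec j (fun a₁ a₂ : A => a₁ + a₂) _ _ _ S.definable_add x y

theorem smul_spec (g : S.GStar j) (a : S.AStar j) :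
    tuple₃ g.1 a.1 (g • a).1 ∈ star j (graph₂ fun (g : G) (a : A) => g • a) :=
  starMap_spec j (fun (g : G) (a : A) => g • a) _ _ _ S.definable_smul g a

theorem hFun_spec (x y : S.GStar j) :
    tuple₃ x.1 y.1 (S.hFun j x y).1 ∈ star j (graph₂ h.toFun) :=
  starMap_spec j h.toFun _ _ _ S.definable_h x y

theorem one_spec : tuple₃ (1 : S.GStar j).1 (1 : S.GStar j).1 (1 : S.GStar j).1 ∈
    star j (graph₂ fun g₁ g₂ : G => g₁ * g₂) := by
  have h1 : tuple₃ (1 : G).1 (1 : G).1 (1 : G).1 ∈ graph₂ fun g₁ g₂ : G => g₁ * g₂ :=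
    (mem_graph₂ _).2 ⟨(1 : G).2, (1 : G).2, by simp⟩
  have h2 := (star_map (j := j) S.definable_mul _).2 h1
  convert! h2 using 1
  funext i; rcases i with i | i | i <;> rfl

theorem zero_spec : tuple₃ (0 : S.AStar j).1 (0 : S.AStar j).1 (0 : S.AStar j).1 ∈
    star j (graph₂ fun a₁ a₂ : A => a₁ + a₂) := by
  have h1 : tuple₃ (0 : A).1 (0 : A).1 (0 : A).1 ∈ graph₂ fun a₁ a₂ : A => a₁ + a₂ :=
    (mem_graph₂ _).2 ⟨(0 : A).2, (0 : A).2, by simp⟩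
  have h2 := (star_map (j := j) S.definable_add _).2 h1
  convert! h2 using 1
  funext i; rcases i with i | i | i <;> rfl

theorem untuple {K α β γ : Type*} {X : Set (α → K)} {Y : Set (β → K)} {Z : Set (γ → K)}
    [Nonempty X] [Nonempty Y] [Nonempty Z] {f : X → Y → Z} {x : α → K} {y : β → K} {z : γ → K}
    (hx : tuple₃ x y z ∈ graph₂ f) : x ∈ X ∧ y ∈ Y ∧ z ∈ Z ∧
      Function.invFun (Subtype.val : Z → γ → K) z =
        f (Function.invFun Subtype.val x) (Function.invFun Subtype.val y) := by
  obtain ⟨h1, h2, rfl⟩ := (mem_graph₂ f).1 hx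
  have e1 := Function.leftInverse_invFun (Subtype.val_injective (p := (· ∈ X))) ⟨x, h1⟩
  have e2 := Function.leftInverse_invFun (Subtype.val_injective (p := (· ∈ Y))) ⟨y, h2⟩
  have e3 := Function.leftInverse_invFun (Subtype.val_injective (p := (· ∈ Z)))
    (f ⟨x, h1⟩ ⟨y, h2⟩)
  refine ⟨h1, h2, Subtype.coe_prop _, ?_⟩
  exact e3.trans (congr (congrArg f e1.symm) e2.symm)

theorem untuple_inj {K γ : Type*} {Z : Set (γ → K)} [Nonempty Z] {z z' : γ → K} (hz : z ∈ Z)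
    (hz' : z' ∈ Z) (h : Function.invFun (Subtype.val : Z → γ → K) z =
      Function.invFun (Subtype.val : Z → γ → K) z') : z = z' := by
  have e1 := Function.leftInverse_invFun (Subtype.val_injective (p := (· ∈ Z))) ⟨z, hz⟩
  have e2 := Function.leftInverse_invFun (Subtype.val_injective (p := (· ∈ Z))) ⟨z', hz'⟩
  exact congrArg Subtype.val (e1.symm.trans (h.trans e2))

theorem star_mul_assoc (x y z : S.GStar j) : x * y * z = x * (y * z) := by
  refine Subtype.ext (funext fun i => ?_)
  have T : Trans j (k := 7) (l := 0) (α := Fin m) (β := Fin n) _ _ :=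
    Trans.imp (Trans.mem₃ S.definable_mul (gv 0) (gv 1) (gv 3)) <|
    Trans.imp (Trans.mem₃ S.definable_mul (gv 3) (gv 2) (gv 4)) <|
    Trans.imp (Trans.mem₃ S.definable_mul (gv 1) (gv 2) (gv 5)) <|
    Trans.imp (Trans.mem₃ S.definable_mul (gv 0) (gv 5) (gv 6)) <|
    Trans.eq_coord (Sum.inl (4, i)) (Sum.inl (6, i))
  refine Trans.all T ?_
    ![x.1, y.1, z.1, (x * y).1, (x * y * z).1, (y * z).1, (x * (y * z)).1]
    ![]
    (S.mul_spec j x y)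
    (S.mul_spec j (x * y) z)
    (S.mul_spec j y z)
    (S.mul_spec j x (y * z))
  intro p q e0 e1 e2 e3
  obtain ⟨x0, y0, z0, e0⟩ := untuple (x := p 0) (y := p 1) (z := p 3) e0
  obtain ⟨x1, y1, z1, e1⟩ := untuple (x := p 3) (y := p 2) (z := p 4) e1
  obtain ⟨x2, y2, z2, e2⟩ := untuple (x := p 1) (y := p 2) (z := p 5) e2
  obtain ⟨x3, y3, z3, e3⟩ := untuple (x := p 0) (y := p 5) (z := p 6) e3
  refine congrFun (untuple_inj z1 z3 ?_ : p 4 = p 6) i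
  rw [e1, e0, e3, e2, mul_assoc]

theorem star_mul_one (x : S.GStar j) : x * 1 = x := by
  refine Subtype.ext (funext fun i => ?_)
  have T : Trans j (k := 3) (l := 0) (α := Fin m) (β := Fin n) _ _ :=
    Trans.imp (Trans.mem₃ S.definable_mul (gv 1) (gv 1) (gv 1)) <|
    Trans.imp (Trans.mem₃ S.definable_mul (gv 0) (gv 1) (gv 2)) <|
    Trans.eq_coord (Sum.inl (2, i)) (Sum.inl (0, i))
  refine Trans.all T ?_
    ![x.1, (1 : S.GStar j).1, (x * 1).1]
    ![]
    (S.one_spec j)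
    (S.mul_spec j x 1)
  intro p q e0 e1
  obtain ⟨x0, y0, z0, e0⟩ := untuple (x := p 1) (y := p 1) (z := p 1) e0
  obtain ⟨x1, y1, z1, e1⟩ := untuple (x := p 0) (y := p 1) (z := p 2) e1
  refine congrFun (untuple_inj z1 x1 ?_ : p 2 = p 0) i
  rw [e1, left_eq_mul.1 e0, mul_one]

theorem star_mul_inv (x : S.GStar j) : x * x⁻¹ = 1 := by
  refine Subtype.ext (funext fun i => ?_)
  have T : Trans j (k := 4) (l := 0) (α := Fin m) (β := Fin n) _ _ :=
    Trans.imp (Trans.mem₃ S.definable_mul (gv 1) (gv 1) (gv 1)) <|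
    Trans.imp (Trans.mem₃ S.definable_ldiv (gv 0) (gv 1) (gv 2)) <|
    Trans.imp (Trans.mem₃ S.definable_mul (gv 0) (gv 2) (gv 3)) <|
    Trans.eq_coord (Sum.inl (3, i)) (Sum.inl (1, i))
  refine Trans.all T ?_
    ![x.1, (1 : S.GStar j).1, (x⁻¹).1, (x * x⁻¹).1]
    ![]
    (S.one_spec j)
    (starMap_spec j (fun g₁ g₂ : G => g₁⁻¹ * g₂) _ _ _ S.definable_ldiv x (1 : S.GStar j))
    (S.mul_spec j x x⁻¹)
  intro p q e0 e1 e2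
  obtain ⟨x0, y0, z0, e0⟩ := untuple (x := p 1) (y := p 1) (z := p 1) e0
  obtain ⟨x1, y1, z1, e1⟩ := untuple (x := p 0) (y := p 1) (z := p 2) e1
  obtain ⟨x2, y2, z2, e2⟩ := untuple (x := p 0) (y := p 2) (z := p 3) e2
  refine congrFun (untuple_inj z2 z0 ?_ : p 3 = p 1) i
  rw [e2, e1, mul_inv_cancel_left]

theorem star_add_assoc (x y z : S.AStar j) : x + y + z = x + (y + z) := by
  refine Subtype.ext (funext fun i => ?_)
  have T : Trans j (k := 0) (l := 7) (α := Fin m) (β := Fin n) _ _ :=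
    Trans.imp (Trans.mem₃ S.definable_add (av 0) (av 1) (av 3)) <|
    Trans.imp (Trans.mem₃ S.definable_add (av 3) (av 2) (av 4)) <|
    Trans.imp (Trans.mem₃ S.definable_add (av 1) (av 2) (av 5)) <|
    Trans.imp (Trans.mem₃ S.definable_add (av 0) (av 5) (av 6)) <|
    Trans.eq_coord (Sum.inr (4, i)) (Sum.inr (6, i))
  refine Trans.all T ?_
    ![]
    ![x.1, y.1, z.1, (x + y).1, (x + y + z).1, (y + z).1, (x + (y + z)).1]
    (S.add_spec j x y)
    (S.add_spec j (x + y) z)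
    (S.add_spec j y z)
    (S.add_spec j x (y + z))
  intro p q e0 e1 e2 e3
  obtain ⟨x0, y0, z0, e0⟩ := untuple (x := q 0) (y := q 1) (z := q 3) e0
  obtain ⟨x1, y1, z1, e1⟩ := untuple (x := q 3) (y := q 2) (z := q 4) e1
  obtain ⟨x2, y2, z2, e2⟩ := untuple (x := q 1) (y := q 2) (z := q 5) e2
  obtain ⟨x3, y3, z3, e3⟩ := untuple (x := q 0) (y := q 5) (z := q 6) e3
  refine congrFun (untuple_inj z1 z3 ?_ : q 4 = q 6) i
  rw [e1, e0, e3, e2, add_assoc]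

theorem star_add_comm (x y : S.AStar j) : x + y = y + x := by
  refine Subtype.ext (funext fun i => ?_)
  have T : Trans j (k := 0) (l := 4) (α := Fin m) (β := Fin n) _ _ :=
    Trans.imp (Trans.mem₃ S.definable_add (av 0) (av 1) (av 2)) <|
    Trans.imp (Trans.mem₃ S.definable_add (av 1) (av 0) (av 3)) <|
    Trans.eq_coord (Sum.inr (2, i)) (Sum.inr (3, i))
  refine Trans.all T ?_
    ![]
    ![x.1, y.1, (x + y).1, (y + x).1]
    (S.add_spec j x y)
    (S.add_spec j y x)
  intro p q e0 e1
  obtain ⟨x0, y0, z0, e0⟩ := untuple (x := q 0) (y := q 1) (z := q 2) e0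
  obtain ⟨x1, y1, z1, e1⟩ := untuple (x := q 1) (y := q 0) (z := q 3) e1
  refine congrFun (untuple_inj z0 z1 ?_ : q 2 = q 3) i
  rw [e0, e1, add_comm]

theorem star_add_zero (x : S.AStar j) : x + 0 = x := by
  refine Subtype.ext (funext fun i => ?_)
  have T : Trans j (k := 0) (l := 3) (α := Fin m) (β := Fin n) _ _ :=
    Trans.imp (Trans.mem₃ S.definable_add (av 1) (av 1) (av 1)) <|
    Trans.imp (Trans.mem₃ S.definable_add (av 0) (av 1) (av 2)) <|
    Trans.eq_coord (Sum.inr (2, i)) (Sum.inr (0, i))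
  refine Trans.all T ?_
    ![]
    ![x.1, (0 : S.AStar j).1, (x + 0).1]
    (S.zero_spec j)
    (S.add_spec j x 0)
  intro p q e0 e1
  obtain ⟨x0, y0, z0, e0⟩ := untuple (x := q 1) (y := q 1) (z := q 1) e0
  obtain ⟨x1, y1, z1, e1⟩ := untuple (x := q 0) (y := q 1) (z := q 2) e1
  refine congrFun (untuple_inj z1 x1 ?_ : q 2 = q 0) i
  rw [e1, left_eq_add.1 e0, add_zero]

theorem star_add_neg (x : S.AStar j) : x + -x = 0 := by
  refine Subtype.ext (funext fun i => ?_)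
  have T : Trans j (k := 0) (l := 4) (α := Fin m) (β := Fin n) _ _ :=
    Trans.imp (Trans.mem₃ S.definable_add (av 1) (av 1) (av 1)) <|
    Trans.imp (Trans.mem₃ S.definable_sub (av 0) (av 1) (av 2)) <|
    Trans.imp (Trans.mem₃ S.definable_add (av 0) (av 2) (av 3)) <|
    Trans.eq_coord (Sum.inr (3, i)) (Sum.inr (1, i))
  refine Trans.all T ?_
    ![]
    ![x.1, (0 : S.AStar j).1, (-x).1, (x + -x).1]
    (S.zero_spec j)
    (starMap_spec j (fun a₁ a₂ : A => -a₁ + a₂) _ _ _ S.definable_sub x (0 : S.AStar j))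
    (S.add_spec j x (-x))
  intro p q e0 e1 e2
  obtain ⟨x0, y0, z0, e0⟩ := untuple (x := q 1) (y := q 1) (z := q 1) e0
  obtain ⟨x1, y1, z1, e1⟩ := untuple (x := q 0) (y := q 1) (z := q 2) e1
  obtain ⟨x2, y2, z2, e2⟩ := untuple (x := q 0) (y := q 2) (z := q 3) e2
  refine congrFun (untuple_inj z2 z0 ?_ : q 3 = q 1) i
  rw [e2, e1, add_neg_cancel_left]

noncomputable instance : Group (S.GStar j) :=
  Group.ofRightAxioms (S.star_mul_assoc j) (S.star_mul_one j) (S.star_mul_inv j)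

noncomputable instance : AddCommGroup (S.AStar j) :=
  { AddGroup.ofRightAxioms (S.star_add_assoc j) (S.star_add_zero j) (S.star_add_neg j) with
    add_comm := S.star_add_comm j }

theorem star_one_smul (a : S.AStar j) : (1 : S.GStar j) • a = a := by
  refine Subtype.ext (funext fun i => ?_)
  have T : Trans j (k := 1) (l := 2) (α := Fin m) (β := Fin n) _ _ :=
    Trans.imp (Trans.mem₃ S.definable_mul (gv 0) (gv 0) (gv 0)) <|
    Trans.imp (Trans.mem₃ S.definable_smul (gv 0) (av 0) (av 1)) <|
    Trans.eq_coord (Sum.inr (1, i)) (Sum.inr (0, i))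
  refine Trans.all T ?_
    ![(1 : S.GStar j).1]
    ![a.1, ((1 : S.GStar j) • a).1]
    (S.one_spec j)
    (S.smul_spec j 1 a)
  intro p q e0 e1
  obtain ⟨x0, y0, z0, e0⟩ := untuple (x := p 0) (y := p 0) (z := p 0) e0
  obtain ⟨x1, y1, z1, e1⟩ := untuple (x := p 0) (y := q 0) (z := q 1) e1
  refine congrFun (untuple_inj z1 y1 ?_ : q 1 = q 0) i
  rw [e1, left_eq_mul.1 e0, one_smul]

theorem star_mul_smul (x y : S.GStar j) (a : S.AStar j) : (x * y) • a = x • y • a := by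
  refine Subtype.ext (funext fun i => ?_)
  have T : Trans j (k := 3) (l := 4) (α := Fin m) (β := Fin n) _ _ :=
    Trans.imp (Trans.mem₃ S.definable_mul (gv 0) (gv 1) (gv 2)) <|
    Trans.imp (Trans.mem₃ S.definable_smul (gv 2) (av 0) (av 1)) <|
    Trans.imp (Trans.mem₃ S.definable_smul (gv 1) (av 0) (av 2)) <|
    Trans.imp (Trans.mem₃ S.definable_smul (gv 0) (av 2) (av 3)) <|
    Trans.eq_coord (Sum.inr (1, i)) (Sum.inr (3, i))
  refine Trans.all T ?_
    ![x.1, y.1, (x * y).1]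
    ![a.1, ((x * y) • a).1, (y • a).1, (x • y • a).1]
    (S.mul_spec j x y)
    (S.smul_spec j (x * y) a)
    (S.smul_spec j y a)
    (S.smul_spec j x (y • a))
  intro p q e0 e1 e2 e3
  obtain ⟨x0, y0, z0, e0⟩ := untuple (x := p 0) (y := p 1) (z := p 2) e0
  obtain ⟨x1, y1, z1, e1⟩ := untuple (x := p 2) (y := q 0) (z := q 1) e1
  obtain ⟨x2, y2, z2, e2⟩ := untuple (x := p 1) (y := q 0) (z := q 2) e2
  obtain ⟨x3, y3, z3, e3⟩ := untuple (x := p 0) (y := q 2) (z := q 3) e3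
  refine congrFun (untuple_inj z1 z3 ?_ : q 1 = q 3) i
  rw [e1, e0, e3, e2, mul_smul]

theorem star_smul_add (x : S.GStar j) (a b : S.AStar j) : x • (a + b) = x • a + x • b := by
  refine Subtype.ext (funext fun i => ?_)
  have T : Trans j (k := 1) (l := 7) (α := Fin m) (β := Fin n) _ _ :=
    Trans.imp (Trans.mem₃ S.definable_add (av 0) (av 1) (av 2)) <|
    Trans.imp (Trans.mem₃ S.definable_smul (gv 0) (av 2) (av 3)) <|
    Trans.imp (Trans.mem₃ S.definable_smul (gv 0) (av 0) (av 4)) <|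
    Trans.imp (Trans.mem₃ S.definable_smul (gv 0) (av 1) (av 5)) <|
    Trans.imp (Trans.mem₃ S.definable_add (av 4) (av 5) (av 6)) <|
    Trans.eq_coord (Sum.inr (3, i)) (Sum.inr (6, i))
  refine Trans.all T ?_
    ![x.1]
    ![a.1, b.1, (a + b).1, (x • (a + b)).1, (x • a).1, (x • b).1, (x • a + x • b).1]
    (S.add_spec j a b)
    (S.smul_spec j x (a + b))
    (S.smul_spec j x a)
    (S.smul_spec j x b)
    (S.add_spec j (x • a) (x • b))
  intro p q e0 e1 e2 e3 e4
  obtain ⟨x0, y0, z0, e0⟩ := untuple (x := q 0) (y := q 1) (z := q 2) e0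
  obtain ⟨x1, y1, z1, e1⟩ := untuple (x := p 0) (y := q 2) (z := q 3) e1
  obtain ⟨x2, y2, z2, e2⟩ := untuple (x := p 0) (y := q 0) (z := q 4) e2
  obtain ⟨x3, y3, z3, e3⟩ := untuple (x := p 0) (y := q 1) (z := q 5) e3
  obtain ⟨x4, y4, z4, e4⟩ := untuple (x := q 4) (y := q 5) (z := q 6) e4
  refine congrFun (untuple_inj z1 z4 ?_ : q 3 = q 6) i
  rw [e1, e0, e4, e2, e3, smul_add]

noncomputable instance : DistribMulAction (S.GStar j) (S.AStar j) where
  one_smul := S.star_one_smul j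
  mul_smul := S.star_mul_smul j
  smul_add := S.star_smul_add j
  smul_zero x := by
    have h0 := S.star_smul_add j x 0 0
    rw [add_zero] at h0
    exact left_eq_add.1 h0

theorem hFun_cocycle (x y z : S.GStar j) :
    S.hFun j x y + S.hFun j (x * y) z = S.hFun j x (y * z) + x • S.hFun j y z := by
  refine Subtype.ext (funext fun i => ?_)
  have T : Trans j (k := 5) (l := 7) (α := Fin m) (β := Fin n) _ _ :=
    Trans.imp (Trans.mem₃ S.definable_mul (gv 0) (gv 1) (gv 3)) <|
    Trans.imp (Trans.mem₃ S.definable_mul (gv 1) (gv 2) (gv 4)) <|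
    Trans.imp (Trans.mem₃ S.definable_h (gv 0) (gv 1) (av 0)) <|
    Trans.imp (Trans.mem₃ S.definable_h (gv 3) (gv 2) (av 1)) <|
    Trans.imp (Trans.mem₃ S.definable_h (gv 0) (gv 4) (av 2)) <|
    Trans.imp (Trans.mem₃ S.definable_h (gv 1) (gv 2) (av 3)) <|
    Trans.imp (Trans.mem₃ S.definable_smul (gv 0) (av 3) (av 4)) <|
    Trans.imp (Trans.mem₃ S.definable_add (av 0) (av 1) (av 5)) <|
    Trans.imp (Trans.mem₃ S.definable_add (av 2) (av 4) (av 6)) <|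
    Trans.eq_coord (Sum.inr (5, i)) (Sum.inr (6, i))
  refine Trans.all T ?_
    ![x.1, y.1, z.1, (x * y).1, (y * z).1]
    ![(S.hFun j x y).1, (S.hFun j (x * y) z).1, (S.hFun j x (y * z)).1, (S.hFun j y z).1,
      (x • S.hFun j y z).1, (S.hFun j x y + S.hFun j (x * y) z).1,
      (S.hFun j x (y * z) + x • S.hFun j y z).1]
    (S.mul_spec j x y)
    (S.mul_spec j y z)
    (S.hFun_spec j x y)
    (S.hFun_spec j (x * y) z)
    (S.hFun_spec j x (y * z))
    (S.hFun_spec j y z)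
    (S.smul_spec j x (S.hFun j y z))
    (S.add_spec j (S.hFun j x y) (S.hFun j (x * y) z))
    (S.add_spec j (S.hFun j x (y * z)) (x • S.hFun j y z))
  intro p q e0 e1 e2 e3 e4 e5 e6 e7 e8
  obtain ⟨x0, y0, z0, e0⟩ := untuple (x := p 0) (y := p 1) (z := p 3) e0
  obtain ⟨x1, y1, z1, e1⟩ := untuple (x := p 1) (y := p 2) (z := p 4) e1
  obtain ⟨x2, y2, z2, e2⟩ := untuple (x := p 0) (y := p 1) (z := q 0) e2
  obtain ⟨x3, y3, z3, e3⟩ := untuple (x := p 3) (y := p 2) (z := q 1) e3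
  obtain ⟨x4, y4, z4, e4⟩ := untuple (x := p 0) (y := p 4) (z := q 2) e4
  obtain ⟨x5, y5, z5, e5⟩ := untuple (x := p 1) (y := p 2) (z := q 3) e5
  obtain ⟨x6, y6, z6, e6⟩ := untuple (x := p 0) (y := q 3) (z := q 4) e6
  obtain ⟨x7, y7, z7, e7⟩ := untuple (x := q 0) (y := q 1) (z := q 5) e7
  obtain ⟨x8, y8, z8, e8⟩ := untuple (x := q 2) (y := q 4) (z := q 6) e8
  refine congrFun (untuple_inj z7 z8 ?_ : q 5 = q 6) i
  rw [e7, e8, e6, e5, e4, e3, e2, e1, e0]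
  exact h.cocycle' _ _ _

theorem hFun_one_right (x : S.GStar j) : S.hFun j x 1 = 0 := by
  refine Subtype.ext (funext fun i => ?_)
  have T : Trans j (k := 2) (l := 2) (α := Fin m) (β := Fin n) _ _ :=
    Trans.imp (Trans.mem₃ S.definable_mul (gv 1) (gv 1) (gv 1)) <|
    Trans.imp (Trans.mem₃ S.definable_add (av 0) (av 0) (av 0)) <|
    Trans.imp (Trans.mem₃ S.definable_h (gv 0) (gv 1) (av 1)) <|
    Trans.eq_coord (Sum.inr (1, i)) (Sum.inr (0, i))
  refine Trans.all T ?_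
    ![x.1, (1 : S.GStar j).1]
    ![(0 : S.AStar j).1, (S.hFun j x 1).1]
    (S.one_spec j)
    (S.zero_spec j)
    (S.hFun_spec j x 1)
  intro p q e0 e1 e2
  obtain ⟨x0, y0, z0, e0⟩ := untuple (x := p 1) (y := p 1) (z := p 1) e0
  obtain ⟨x1, y1, z1, e1⟩ := untuple (x := q 0) (y := q 0) (z := q 0) e1
  obtain ⟨x2, y2, z2, e2⟩ := untuple (x := p 0) (y := p 1) (z := q 1) e2
  refine congrFun (untuple_inj z2 z1 ?_ : q 1 = q 0) i
  rw [e2, left_eq_mul.1 e0, left_eq_add.1 e1, h.map_one_right']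

theorem hFun_one_left (x : S.GStar j) : S.hFun j 1 x = 0 := by
  refine Subtype.ext (funext fun i => ?_)
  have T : Trans j (k := 2) (l := 2) (α := Fin m) (β := Fin n) _ _ :=
    Trans.imp (Trans.mem₃ S.definable_mul (gv 1) (gv 1) (gv 1)) <|
    Trans.imp (Trans.mem₃ S.definable_add (av 0) (av 0) (av 0)) <|
    Trans.imp (Trans.mem₃ S.definable_h (gv 1) (gv 0) (av 1)) <|
    Trans.eq_coord (Sum.inr (1, i)) (Sum.inr (0, i))
  refine Trans.all T ?_
    ![x.1, (1 : S.GStar j).1]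
    ![(0 : S.AStar j).1, (S.hFun j 1 x).1]
    (S.one_spec j)
    (S.zero_spec j)
    (S.hFun_spec j 1 x)
  intro p q e0 e1 e2
  obtain ⟨x0, y0, z0, e0⟩ := untuple (x := p 1) (y := p 1) (z := p 1) e0
  obtain ⟨x1, y1, z1, e1⟩ := untuple (x := q 0) (y := q 0) (z := q 0) e1
  obtain ⟨x2, y2, z2, e2⟩ := untuple (x := p 1) (y := p 0) (z := q 1) e2
  refine congrFun (untuple_inj z2 z1 ?_ : q 1 = q 0) i
  rw [e2, left_eq_mul.1 e0, left_eq_add.1 e1, h.map_one_left']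

/-- The 2-cocycle `h*` of the interpretation. -/
noncomputable def hStar : TwoCocycle (S.GStar j) (S.AStar j) where
  toFun := S.hFun j
  cocycle' := S.hFun_cocycle j
  map_one_right' := S.hFun_one_right j
  map_one_left' := S.hFun_one_left j

/-- The interpretation of the extension of `G` by `A` given by `h`: the extension of `G*` by `A*`
given by `h*`. -/
abbrev ExtStar : Type w' := CocycleExtension (S.hStar j)

/-- The tuple of elements of the structure that is a given element of the extension. -/
def coordExt (x : S.ExtStar j) : Fin n ⊕ Fin m → N :=
  Sum.elim (S.coordA j x.fst) (S.coordG j x.snd)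

end DefinableExtension

end Situation

section Components

open FirstOrder FirstOrder.Language Cardinal

/-- `N` is `κ`-saturated: every finitely satisfiable set of formulas in finitely many variables
over a set of fewer than `κ` parameters is realized. -/
def IsSaturated (L : FirstOrder.Language.{u, v}) (κ : Cardinal.{w'}) (N : Type w')
    [L.Structure N] : Prop :=
  ∀ C : Set N, #C < κ → ∀ (k : ℕ) (p : Set (L[[C]].Formula (Fin k))),
    (∀ p₀ : Finset (L[[C]].Formula (Fin k)), (p₀ : Set (L[[C]].Formula (Fin k))) ⊆ p →
      ∃ t : Fin k → N, ∀ φ ∈ p₀, φ.Realize t) →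
    ∃ t : Fin k → N, ∀ φ ∈ p, φ.Realize t

/-- `N` is strongly `κ`-homogeneous: every partial elementary map whose domain has fewer than `κ`
elements extends to an automorphism. -/
def IsStronglyHomogeneous (L : FirstOrder.Language.{u, v}) (κ : Cardinal.{w'}) (N : Type w')
    [L.Structure N] : Prop :=
  ∀ C : Set N, #C < κ → ∀ f : C → N,
    (∀ φ : L.Formula C, φ.Realize (fun c : C => (c : N)) ↔ φ.Realize f) →
    ∃ σ : N ≃[L] N, ∀ c : C, σ c = f c

/-- `N` is a monster model with respect to the cardinal `κ` (which is large compared with the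
language): it is `κ`-saturated and strongly `κ`-homogeneous. Sizes less than `κ` are small, or
bounded. -/
structure IsMonster (L : FirstOrder.Language.{u, v}) (κ : Cardinal.{w'}) (N : Type w')
    [L.Structure N] : Prop where
  large : Cardinal.lift.{w'} (2 ^ max ℵ₀ L.card) < Cardinal.lift.{max u v} κ
  saturated : IsSaturated L κ N
  homogeneous : IsStronglyHomogeneous L κ N

/-- A set of tuples is invariant over `C` if every automorphism fixing `C` pointwise maps it into
(hence onto) itself. -/
def IsInvariantOver (L : FirstOrder.Language.{u, v}) {N : Type w'} [L.Structure N] (C : Set N)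
    {ι : Type*} (T : Set (ι → N)) : Prop :=
  ∀ σ : N ≃[L] N, (∀ c ∈ C, σ c = c) → ∀ t ∈ T, σ ∘ t ∈ T

/-- A set of tuples is type-definable over `C` if it is an intersection of sets definable
over `C`. -/
def IsTypeDefinableOver (L : FirstOrder.Language.{u, v}) {N : Type w'} [L.Structure N]
    (C : Set N) {ι : Type*} (T : Set (ι → N)) : Prop :=
  ∃ F : Set (Set (ι → N)), (∀ D ∈ F, C.Definable L D) ∧ T = ⋂₀ F

/-- The component `Γ⁰⁰⁰` over `C` of a group `Γ` whose elements are tuples of `N` (through `coord`):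
the smallest subgroup of bounded index that is invariant over `C`, that is, the intersection of
all such subgroups. -/
def component000 (L : FirstOrder.Language.{u, v}) {N : Type w'} [L.Structure N]
    (κ : Cardinal.{w'}) (C : Set N) {Γ : Type w'} [Group Γ] {ι : Type*} (coord : Γ → ι → N) :
    Subgroup Γ :=
  sInf {H : Subgroup Γ | #(Γ ⧸ H) < κ ∧ IsInvariantOver L C (coord '' (H : Set Γ))}

/-- The component `Γ⁰⁰` over `C` of a group `Γ` whose elements are tuples of `N` (through `coord`):
the smallest subgroup of bounded index that is type-definable over `C`, that is, the intersection
of all such subgroups. -/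
def component00 (L : FirstOrder.Language.{u, v}) {N : Type w'} [L.Structure N]
    (κ : Cardinal.{w'}) (C : Set N) {Γ : Type w'} [Group Γ] {ι : Type*} (coord : Γ → ι → N) :
    Subgroup Γ :=
  sInf {H : Subgroup Γ | #(Γ ⧸ H) < κ ∧ IsTypeDefinableOver L C (coord '' (H : Set Γ))}

namespace DefinableExtension

variable {L : FirstOrder.Language.{u, v}} {M : Type w} [L.Structure M]
  {B : Set M} {m n : ℕ} {G : Set (Fin m → M)} {A : Set (Fin n → M)} [Group G]
  [AddCommGroup A] [DistribMulAction G A] {h : TwoCocycle G A}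
  {N : Type w'} [L.Structure N]
  (S : DefinableExtension L B G A h) (j : M ↪ₑ[L] N) (κ : Cardinal.{w'})

/-- `G*⁰⁰⁰` over `B`. -/
noncomputable def G000 : Subgroup (S.GStar j) := component000 L κ (j '' B) (S.coordG j)

/-- `G*⁰⁰` over `B`. -/
noncomputable def G00 : Subgroup (S.GStar j) := component00 L κ (j '' B) (S.coordG j)

/-- The component `⁰⁰⁰` over `B` of the interpretation of the extension. -/
noncomputable def Ext000 : Subgroup (S.ExtStar j) := component000 L κ (j '' B) (S.coordExt j)

/-- The component `⁰⁰` over `B` of the interpretation of the extension. -/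
noncomputable def Ext00 : Subgroup (S.ExtStar j) := component00 L κ (j '' B) (S.coordExt j)

end DefinableExtension

end Components

end GroupExtComponents

/-! Write `K` and `T` for the 000- and 00-components of the extension and project to `G*`. The image
of `K` is an invariant subgroup of bounded index, so it contains the 000-component of `G*`
(`exists_mem_Ext000`). The preimage of a type-definable subgroup of bounded index is again one, so
`T` projects into the 00-component of `G*` (`snd_mem_G00`). When the two components of `G*` agree,
every element of `T` differs from an element of `K` by an element of `A*`. Hence `T = (T ∩ A*) K`,
and the second isomorphism theorem gives `T / K ≅ (T ∩ A*) / (K ∩ A*)` (`exists_quotient_equiv`).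
The isomorphism relates `x` to `a` exactly when `x⁻¹ a ∈ K`, so it is invariant because `K` is.

This needs `K` itself to have bounded index and to be normal. Both follow from one fact
(`IsInvariantGroup.inv_mul_mem`): if `H` is invariant of bounded index and `x`, `y` have the same
type over a small model `M₀ ⊇ C`, then `x⁻¹ y ∈ H`. To see this, let `a` realize a coheir of that
type over `x`, `y` and representatives of all cosets of `H` that meet the type. One representative
`r` satisfies `r⁻¹ a ∈ H`; coheirs do not split, so `x⁻¹ a` and `y⁻¹ a` lie in `H` too.

The same `M₀` serves all `H`, so the intersection `K` has at most as many cosets as there are types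
over `M₀`, fewer than `κ`. A second coheir argument extends the fact to normal cores
(`IsInvariantGroup.inv_mul_mem_normalCore`). So the normal core of `K` is again invariant of bounded
index, and minimality makes it equal to `K`. -/

namespace GroupExtComponents

/-! ### Types, automorphisms, coheirs and small elementary substructures. -/

section TypesAndCoheirs

open FirstOrder FirstOrder.Language Cardinal

variable {L : FirstOrder.Language.{u, v}} {N : Type w'} [L.Structure N] {κ : Cardinal.{w'}}

/-- Two tuples have the same type over `D`. -/
def SameType (L : FirstOrder.Language.{u, v}) {N : Type w'} [L.Structure N] (D : Set N)
    {ι : Type*} (s t : ι → N) : Prop :=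
  ∀ φ : L.Formula (D ⊕ ι),
    φ.Realize (Sum.elim (fun d : D => (d : N)) s) ↔ φ.Realize (Sum.elim (fun d : D => (d : N)) t)

theorem SameType.symm {D : Set N} {ι : Type*} {s t : ι → N} (h : SameType L D s t) :
    SameType L D t s := fun φ => (h φ).symm

theorem SameType.trans {D : Set N} {ι : Type*} {r s t : ι → N} (h : SameType L D r s)
    (h' : SameType L D s t) : SameType L D r t := fun φ => (h φ).trans (h' φ)

theorem sameType_comp_equiv {D : Set N} {ι : Type*} (σ : N ≃[L] N) (hσ : ∀ d ∈ D, σ d = d)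
    (s : ι → N) : SameType L D s (σ ∘ s) := by
  intro φ
  rw [← StrongHomClass.realize_formula σ φ, Sum.comp_elim]
  have : (σ : N → N) ∘ (fun d : D => (d : N)) = fun d : D => (d : N) :=
    funext fun d => hσ d d.2
  rw [this]

theorem IsMonster.aleph0_le (hN : IsMonster L κ N) : ℵ₀ ≤ κ := by
  have h1 : (ℵ₀ : Cardinal.{max u v}) ≤ 2 ^ max ℵ₀ L.card :=
    (le_max_left _ _).trans (cantor _).le
  have h2 := (lift_le.{w'}.2 h1).trans hN.large.le
  rwa [lift_aleph0, aleph0_le_lift] at h2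

/-- An elementary map defined on a small family of elements extends to an automorphism. -/
theorem IsStronglyHomogeneous.exists_equiv (hN : IsStronglyHomogeneous L κ N) {J : Type*}
    (r s : J → N) (hr : #(Set.range r) < κ)
    (h : ∀ φ : L.Formula J, φ.Realize r ↔ φ.Realize s) :
    ∃ σ : N ≃[L] N, ∀ i, σ (r i) = s i := by
  choose e he using fun c : Set.range r => c.2
  obtain ⟨σ, hσ⟩ := hN (Set.range r) hr (s ∘ e) fun φ => by
    have := h (φ.relabel e)
    rw [Formula.realize_relabel, Formula.realize_relabel] at this
    rw [← this]
    exact iff_of_eq (congrArg _ (funext fun c => (he c).symm))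
  refine ⟨σ, fun i => ?_⟩
  rw [hσ ⟨r i, i, rfl⟩]
  -- The chosen preimage of `r i` need not be `i`; comparing the formula equating the two variables
  -- shows that `s` agrees on them.
  have := h ((Term.var (e ⟨r i, i, rfl⟩)).equal (Term.var i))
  simp only [Formula.realize_equal, Term.realize_var] at this
  exact this.1 (he _)

theorem SameType.exists_equiv (hN : IsMonster L κ N) {D : Set N} (hD : #D < κ) {ι : Type*}
    [Finite ι] {s t : ι → N} (h : SameType L D s t) :
    ∃ σ : N ≃[L] N, (∀ d ∈ D, σ d = d) ∧ σ ∘ s = t := by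
  obtain ⟨σ, hσ⟩ := hN.homogeneous.exists_equiv (Sum.elim (fun d : D => (d : N)) s)
    (Sum.elim (fun d : D => (d : N)) t) (by
      rw [Set.Sum.elim_range, Subtype.range_coe]
      exact (mk_union_le _ _).trans_lt (add_lt_of_lt hN.aleph0_le hD
        ((Set.finite_range s).lt_aleph0.trans_le hN.aleph0_le))) h
  exact ⟨σ, fun d hd => hσ (Sum.inl ⟨d, hd⟩), funext fun i => hσ (Sum.inr i)⟩

/-- The type of a tuple over an elementary substructure extends to an ultrafilter on the set of
tuples of the substructure. -/
theorem exists_coheir (M₀ : L.ElementarySubstructure N) {ι : Type*} [Finite ι] (s : ι → N) :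
    ∃ U : Ultrafilter (ι → M₀), ∀ φ : L.Formula ((M₀ : Set N) ⊕ ι),
      φ.Realize (Sum.elim (fun d : (M₀ : Set N) => (d : N)) s) →
      ∀ᶠ m in (U : Filter (ι → M₀)),
        φ.Realize (Sum.elim (fun d : (M₀ : Set N) => (d : N)) fun i => (m i : N)) := by
  let X : L.Formula ((M₀ : Set N) ⊕ ι) → Set (ι → M₀) := fun φ =>
    {m | φ.Realize (Sum.elim (fun d : (M₀ : Set N) => (d : N)) fun i => (m i : N))}
  obtain ⟨U, hU⟩ := Ultrafilter.exists_ultrafilter_of_finite_inter_nonempty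
    (X '' {φ | φ.Realize (Sum.elim (fun d : (M₀ : Set N) => (d : N)) s)}) (by
      classical
      intro T hT
      -- A conjunction of formulas true of `s` is true of `s`, so a finite intersection contains a
      -- single set `X φ`.
      have key : ∃ φ : L.Formula ((M₀ : Set N) ⊕ ι),
          φ.Realize (Sum.elim (fun d : (M₀ : Set N) => (d : N)) s) ∧
          X φ ⊆ ⋂₀ (T : Set (Set (ι → M₀))) := by
        induction T using Finset.induction_on with
        | empty => exact ⟨⊤, by simp, by simp⟩
        | insert Y T _ ih =>
          rw [Finset.coe_insert, Set.insert_subset_iff] at hT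
          obtain ⟨φ, h1, h2⟩ := ih hT.2
          obtain ⟨ψ, h3, rfl⟩ := hT.1
          refine ⟨ψ ⊓ φ, Formula.realize_inf.2 ⟨h3, h1⟩, ?_⟩
          rw [Finset.coe_insert, Set.sInter_insert]
          intro m hm
          have hm' := Formula.realize_inf.1 hm
          exact ⟨hm'.1, h2 hm'.2⟩
      obtain ⟨φ, h1, h2⟩ := key
      -- In `N` the tuple `s` witnesses the existential formula; elementarity moves the witness into
      -- `M₀`, so `X φ` is nonempty.
      have h3 : (φ.iExs ι).Realize (M₀.subtype ∘ id) := Formula.realize_iExs.2 ⟨s, h1⟩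
      rw [M₀.subtype.map_formula, Formula.realize_iExs] at h3
      obtain ⟨m, hm⟩ := h3
      rw [← M₀.subtype.map_formula, Sum.comp_elim] at hm
      exact ⟨m, h2 hm⟩)
  exact ⟨U, fun φ hφ => hU ⟨φ, hφ, rfl⟩⟩

/-- `t` realizes over `D` the type given by the ultrafilter `U`. -/
def RealizesCoheir (L : FirstOrder.Language.{u, v}) {N : Type w'} [L.Structure N] {M₀ : Type*}
    (c : M₀ → N) (D : Set N) {ι : Type*} (U : Ultrafilter (ι → M₀)) (t : ι → N) : Prop :=
  ∀ φ : L.Formula (D ⊕ ι), φ.Realize (Sum.elim (fun d : D => (d : N)) t) ↔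
    ∀ᶠ m in (U : Filter (ι → M₀)), φ.Realize (Sum.elim (fun d : D => (d : N)) (c ∘ m))

/-- An ultrafilter decides every formula, so the converse implication comes from the given one
applied to negations. -/
theorem realizesCoheir_of_imp {M₀ : Type*} {c : M₀ → N} {D : Set N} {ι : Type*}
    {U : Ultrafilter (ι → M₀)} {t : ι → N}
    (h : ∀ φ : L.Formula (D ⊕ ι),
      (∀ᶠ m in (U : Filter (ι → M₀)), φ.Realize (Sum.elim (fun d : D => (d : N)) (c ∘ m))) →
      φ.Realize (Sum.elim (fun d : D => (d : N)) t)) : RealizesCoheir L c D U t := by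
  refine fun φ => ⟨fun h1 => ?_, h φ⟩
  by_contra h2
  rw [← Ultrafilter.eventually_not] at h2
  have := h φ.not (by simpa only [Formula.realize_not] using h2)
  exact Formula.realize_not.1 this h1

/-- Finitely many formulas that hold along `U` hold together at some `m`, so the type defined by `U`
over `D` is finitely satisfiable and saturation realizes it. -/
theorem IsSaturated.exists_realizesCoheir (hN : IsSaturated L κ N) {M₀ : Type*} (c : M₀ → N)
    {D : Set N} (hD : #D < κ) {ι : Type*} [Finite ι] (U : Ultrafilter (ι → M₀)) :
    ∃ t, RealizesCoheir L c D U t := by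
  obtain ⟨k, ⟨e⟩⟩ := Finite.exists_equiv_fin ι
  have transl : ∀ (φ : L[[D]].Formula (Fin k)) (t : Fin k → N), φ.Realize t ↔
      Formula.Realize (L := L) (BoundedFormula.constantsVarsEquiv φ)
        (Sum.elim (fun d : D => (d : N)) t) := by
    intro φ t
    exact (BoundedFormula.realize_constantsVarsEquiv (φ := φ) (v := t) (xs := default)).symm
  obtain ⟨t, ht⟩ := hN D hD k
    {φ | ∀ᶠ m in (U : Filter (ι → M₀)), φ.Realize (c ∘ m ∘ e.symm)} (by
      intro p hp
      have : ∀ᶠ m in (U : Filter (ι → M₀)), ∀ φ ∈ p, φ.Realize (c ∘ m ∘ e.symm) := by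
        rw [Filter.eventually_all_finset]
        exact fun φ hφ => hp hφ
      obtain ⟨m, hm⟩ := this.exists
      exact ⟨_, hm⟩)
  refine ⟨t ∘ e, realizesCoheir_of_imp fun φ hφ => ?_⟩
  have h1 := ht (BoundedFormula.constantsVarsEquiv.symm (φ.relabel (Sum.map id e))) (by
    refine hφ.mono fun m hm => ?_
    rw [transl, Equiv.apply_symm_apply, Formula.realize_relabel, Sum.elim_comp_map]
    convert! hm using 2
    funext i
    simp)
  rwa [transl, Equiv.apply_symm_apply, Formula.realize_relabel, Sum.elim_comp_map] at h1

theorem RealizesCoheir.realize_iff {M₀ : Type*} {c : M₀ → N} {D : Set N} {ι : Type*}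
    {U : Ultrafilter (ι → M₀)} {t : ι → N} (h : RealizesCoheir L c D U t) {J : Type*}
    (r : J → N) (hr : ∀ i, r i ∈ D) (φ : L.Formula (J ⊕ ι)) :
    φ.Realize (Sum.elim r t) ↔
      ∀ᶠ m in (U : Filter (ι → M₀)), φ.Realize (Sum.elim r (c ∘ m)) := by
  have := h (φ.relabel (Sum.map (fun i => (⟨r i, hr i⟩ : D)) id))
  simp only [Formula.realize_relabel, Sum.elim_comp_map] at this
  exact this

/-- A realization of a coheir of the type of `s` realizes the type of `s`. -/
theorem RealizesCoheir.sameType {M₀ : Type*} {c : M₀ → N} {D E : Set N} {ι : Type*}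
    {U : Ultrafilter (ι → M₀)} {s t : ι → N} (h : RealizesCoheir L c D U t) (hE : E ⊆ D)
    (hU : ∀ φ : L.Formula (E ⊕ ι), φ.Realize (Sum.elim (fun d : E => (d : N)) s) →
      ∀ᶠ m in (U : Filter (ι → M₀)), φ.Realize (Sum.elim (fun d : E => (d : N)) (c ∘ m))) :
    SameType L E s t := by
  have h1 : ∀ φ : L.Formula (E ⊕ ι), φ.Realize (Sum.elim (fun d : E => (d : N)) s) →
      φ.Realize (Sum.elim (fun d : E => (d : N)) t) :=
    fun φ hφ => (h.realize_iff (fun d : E => (d : N)) (fun d => hE d.2) φ).2 (hU φ hφ)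
  refine fun φ => ⟨h1 φ, fun h2 => ?_⟩
  by_contra h3
  exact Formula.realize_not.1 (h1 φ.not (Formula.realize_not.2 h3)) h2

/-- A coheir does not split. -/
theorem RealizesCoheir.sameType_elim {M₀ : L.ElementarySubstructure N} {D : Set N} {ι ι' : Type*}
    {U : Ultrafilter (ι → M₀)} {t : ι → N}
    (h : RealizesCoheir L (fun d : M₀ => (d : N)) D U t) (hD : (M₀ : Set N) ⊆ D)
    {x y : ι' → N} (hx : ∀ i, x i ∈ D) (hy : ∀ i, y i ∈ D) (hxy : SameType L (M₀ : Set N) x y) :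
    SameType L (M₀ : Set N) (Sum.elim x t) (Sum.elim y t) := by
  intro φ
  -- Whether `φ(z, t)` holds depends only on which tuples `m` of `M₀` satisfy `φ(z, m)`, and each
  -- `φ(z, m)` is a condition on the type of `z` over `M₀`.
  have key : ∀ z : ι' → N, (∀ i, z i ∈ D) →
      (φ.Realize (Sum.elim (fun d : (M₀ : Set N) => (d : N)) (Sum.elim z t)) ↔
        ∀ᶠ m in (U : Filter (ι → M₀)), φ.Realize (Sum.elim (fun d : (M₀ : Set N) => (d : N))
          (Sum.elim z fun i => (m i : N)))) := by
    intro z hz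
    have := h.realize_iff (Sum.elim (fun d : (M₀ : Set N) => (d : N)) z)
      (by rintro (d | i); exacts [hD d.2, hz i])
      (φ.relabel (Sum.elim (Sum.inl ∘ Sum.inl) (Sum.elim (Sum.inl ∘ Sum.inr) Sum.inr)))
    simp only [Formula.realize_relabel, Sum.comp_elim] at this
    exact this
  rw [key x hx, key y hy]
  refine Filter.eventually_congr (Filter.Eventually.of_forall fun m => ?_)
  have := hxy (φ.relabel (Sum.elim Sum.inl (Sum.elim Sum.inr fun i => Sum.inl (m i))))
  simp only [Formula.realize_relabel, Sum.comp_elim] at this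
  exact this

/-- There are elementary substructures of at most the size of the language that contain a
given set. -/
theorem exists_small_elementarySubstructure (L : FirstOrder.Language.{u, v}) {N : Type w'}
    [L.Structure N] {C : Set N} (hC : C.Finite) :
    ∃ M₀ : L.ElementarySubstructure N, C ⊆ M₀ ∧
      Cardinal.lift.{max u v} #(M₀ : Set N) ≤ Cardinal.lift.{w'} (max ℵ₀ L.card) := by
  by_cases h : Cardinal.lift.{w'} (max ℵ₀ L.card) ≤ Cardinal.lift.{max u v} #N
  · obtain ⟨M₀, h1, h2⟩ := exists_elementarySubstructure_card_eq L C (max ℵ₀ L.card)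
      (le_max_left _ _) ((lift_lt_aleph0.2 hC.lt_aleph0).le.trans
        (aleph0_le_lift.2 (le_max_left _ _))) (lift_le.2 (le_max_right _ _)) h
    exact ⟨M₀, h1, h2.le⟩
  -- If `N` has fewer than `|L| + ℵ₀` elements, it is itself small enough.
  · refine ⟨⊤, fun _ _ => trivial, (lift_le.2 (mk_set_le _)).trans (not_le.1 h).le⟩

/-- There are fewer than `κ` types over a small elementary substructure. -/
theorem IsMonster.lift_mk_formula_lt (hN : IsMonster L κ N) {D : Set N}
    (hD : Cardinal.lift.{max u v} #D ≤ Cardinal.lift.{w'} (max ℵ₀ L.card)) {ι : Type}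
    [Finite ι] :
    #(Set (L.Formula (D ⊕ ι))) < Cardinal.lift.{max u v} κ := by
  have h1 : #(L.Formula (D ⊕ ι)) ≤ Cardinal.lift.{w'} (max ℵ₀ L.card) := by
    have h2 : #(L.Formula (D ⊕ ι)) ≤ #(Σ n, L.BoundedFormula (D ⊕ ι) n) :=
      mk_le_of_injective (f := fun φ : L.Formula (D ⊕ ι) => ⟨0, φ⟩) fun _ _ e => by
        simpa using! e
    refine h2.trans (BoundedFormula.card_le.trans ?_)
    have h3 : (ℵ₀ : Cardinal.{max u v w'}) ≤ Cardinal.lift.{w'} (max ℵ₀ L.card) :=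
      aleph0_le_lift.2 (le_max_left _ _)
    refine max_le h3 (add_le_of_le h3 ?_ (lift_le.2 (le_max_right _ _)))
    rw [mk_sum, lift_add]
    refine add_le_of_le h3 (by simpa using hD) ?_
    exact le_trans (by simp) h3
  rw [mk_set]
  refine lt_of_le_of_lt (power_le_power_left two_ne_zero h1) ?_
  rw [← lift_two.{w', max u v}, ← lift_power]
  exact hN.large

theorem IsMonster.mk_lt (hN : IsMonster L κ N) {D : Set N}
    (hD : Cardinal.lift.{max u v} #D ≤ Cardinal.lift.{w'} (max ℵ₀ L.card)) : #D < κ := by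
  rw [← lift_lt.{w', max u v}]
  refine hD.trans_lt (lt_of_le_of_lt ?_ hN.large)
  exact lift_le.2 (cantor _).le

end TypesAndCoheirs

/-! ### Invariant subgroups of bounded index: index and normality of the 000-component. -/

section BoundedIndex

open FirstOrder FirstOrder.Language Cardinal

variable {L : FirstOrder.Language.{u, v}} {N : Type w'} [L.Structure N] {κ : Cardinal.{w'}}
  {C : Set N} {Γ : Type w'} [Group Γ] {ι : Type} {coord : Γ → ι → N}

/-- The group `Γ`, whose elements are tuples of `N` through the injective map `coord`, is invariant
over `C`: the automorphisms of `N` over `C` act on it by endomorphisms. -/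
structure IsInvariantGroup (L : FirstOrder.Language.{u, v}) {N : Type w'} [L.Structure N]
    (C : Set N) {Γ : Type w'} [Group Γ] {ι : Type} (coord : Γ → ι → N) : Prop where
  injective : Function.Injective coord
  exists_hom : ∀ σ : N ≃[L] N, (∀ c ∈ C, σ c = c) →
    ∃ s : Γ →* Γ, ∀ x, coord (s x) = σ ∘ coord x

theorem equiv_symm_apply_eq {σ : N ≃[L] N} (hσ : ∀ c ∈ C, σ c = c) : ∀ c ∈ C, σ.symm c = c := by
  intro c hc
  conv_lhs => rw [← hσ c hc]
  exact σ.symm_apply_apply c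

theorem IsInvariantGroup.exists_equiv (hΓ : IsInvariantGroup L C coord) (σ : N ≃[L] N)
    (hσ : ∀ c ∈ C, σ c = c) : ∃ s : Γ ≃* Γ, ∀ x, coord (s x) = σ ∘ coord x := by
  obtain ⟨s, hs⟩ := hΓ.exists_hom σ hσ
  obtain ⟨t, ht⟩ := hΓ.exists_hom σ.symm (equiv_symm_apply_eq hσ)
  refine ⟨{ s with invFun := t, left_inv := fun x => hΓ.injective ?_,
                   right_inv := fun x => hΓ.injective ?_ }, hs⟩
  · change coord (t (s x)) = _
    rw [ht, hs]
    funext i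
    exact σ.symm_apply_apply _
  · change coord (s (t x)) = _
    rw [hs, ht]
    funext i
    exact σ.apply_symm_apply _

/-- Moves invariance from sets of tuples to the group. As `coord` is injective, the induced map `s`
is determined by `σ`, so any candidate may be used. -/
theorem IsInvariantGroup.isInvariantOver_iff (hΓ : IsInvariantGroup L C coord) {H : Set Γ} :
    IsInvariantOver L C (coord '' H) ↔
      ∀ (σ : N ≃[L] N) (s : Γ → Γ), (∀ c ∈ C, σ c = c) → (∀ x, coord (s x) = σ ∘ coord x) →
        ∀ x ∈ H, s x ∈ H := by
  constructor
  · intro h σ s hσ hs x hx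
    obtain ⟨y, hy, e⟩ := h σ hσ _ ⟨x, hx, rfl⟩
    rw [← hs] at e
    rwa [← hΓ.injective e]
  · rintro h σ hσ _ ⟨x, hx, rfl⟩
    obtain ⟨s, hs⟩ := hΓ.exists_hom σ hσ
    exact ⟨s x, h σ s hσ hs x hx, hs x⟩

theorem IsInvariantGroup.isInvariantOver_component000 (hΓ : IsInvariantGroup L C coord) :
    IsInvariantOver L C (coord '' (component000 L κ C coord : Set Γ)) := by
  rw [hΓ.isInvariantOver_iff]
  intro σ s hσ hs x hx
  simp only [component000, SetLike.mem_coe, Subgroup.mem_sInf] at hx ⊢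
  exact fun H hH => hΓ.isInvariantOver_iff.1 hH.2 σ s hσ hs x (hx H hH)

theorem component000_le {H : Subgroup Γ} (hH : #(Γ ⧸ H) < κ)
    (hHinv : IsInvariantOver L C (coord '' (H : Set Γ))) : component000 L κ C coord ≤ H :=
  sInf_le ⟨hH, hHinv⟩

theorem IsTypeDefinableOver.isInvariantOver {ι : Type*} {T : Set (ι → N)}
    (hT : IsTypeDefinableOver L C T) : IsInvariantOver L C T := by
  obtain ⟨F, hF, rfl⟩ := hT
  intro σ hσ t ht D hD
  obtain ⟨φ, hφ⟩ := Set.definable_iff_exists_formula_sum.1 (hF D hD)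
  have h1 := ht D hD
  rw [hφ] at h1 ⊢
  exact (sameType_comp_equiv σ hσ t φ).1 h1

theorem component000_le_component00 : component000 L κ C coord ≤ component00 L κ C coord :=
  sInf_le_sInf fun _ hH => ⟨hH.1, hH.2.isInvariantOver⟩

variable [Finite ι]

/-- An invariant subgroup of bounded index contains the quotients of elements with the same type
over a small elementary substructure. -/
theorem IsInvariantGroup.inv_mul_mem (hΓ : IsInvariantGroup L C coord) (hN : IsMonster L κ N)
    {H : Subgroup Γ} (hH : #(Γ ⧸ H) < κ) (hHinv : IsInvariantOver L C (coord '' (H : Set Γ)))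
    {M₀ : L.ElementarySubstructure N} (hM₀ : #(M₀ : Set N) < κ) (hC : C ⊆ M₀) {x y : Γ}
    (hxy : SameType L (M₀ : Set N) (coord x) (coord y)) : x⁻¹ * y ∈ H := by
  -- `P` is the type of `x` over `M₀`, `Q` the set of cosets of `H` that meet it, and `r` picks a
  -- representative in `P` of each. Bounded index keeps the parameter set `D` containing all of them
  -- small.
  let P : Set Γ := {r | SameType L (M₀ : Set N) (coord x) (coord r)}
  let Q : Set (Γ ⧸ H) := QuotientGroup.mk '' P
  choose r hrP hrQ using fun q : Q => q.2
  obtain ⟨U, hU⟩ := exists_coheir M₀ (coord x)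
  let D : Set N := M₀ ∪ ((Set.range (coord x) ∪ Set.range (coord y)) ∪
    Set.range fun z : Q × ι => coord (r z.1) z.2)
  have hinf := hN.aleph0_le
  have hfin : ∀ z : ι → N, #(Set.range z) < κ := fun z =>
    (Set.finite_range z).lt_aleph0.trans_le hinf
  have hD : #D < κ := by
    refine (mk_union_le _ _).trans_lt (add_lt_of_lt hinf hM₀ ?_)
    refine (mk_union_le _ _).trans_lt (add_lt_of_lt hinf ?_ ?_)
    · exact (mk_union_le _ _).trans_lt (add_lt_of_lt hinf (hfin _) (hfin _))
    · refine mk_range_le.trans_lt ?_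
      rw [mk_prod]
      refine mul_lt_of_lt hinf ?_ ?_
      · rw [lift_id']
        exact (mk_set_le Q).trans_lt hH
      · refine lt_of_lt_of_le ?_ hinf
        rw [lift_lt_aleph0]
        exact lt_aleph0_of_finite ι
  obtain ⟨t, ht⟩ := hN.saturated.exists_realizesCoheir (fun d : M₀ => (d : N)) hD U
  have hsub : (M₀ : Set N) ⊆ D := Set.subset_union_left
  have hxt : SameType L (M₀ : Set N) (coord x) t := ht.sameType hsub hU
  -- The realization `t` is only a tuple; an automorphism over `M₀` taking `x` to `t` shows that it
  -- is the tuple of an element `a` of `Γ`.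
  obtain ⟨τ, hτ, hτx⟩ := hxt.exists_equiv hN hM₀
  obtain ⟨s, hs⟩ := hΓ.exists_hom τ fun c hc => hτ c (hC hc)
  have hst : coord (s x) = t := (hs x).trans hτx
  rw [← hst] at ht hxt
  set a := s x
  let q : Q := ⟨QuotientGroup.mk a, a, hxt, rfl⟩
  have hra : (r q)⁻¹ * a ∈ H := QuotientGroup.eq.1 (hrQ q)
  -- By nonsplitting, an automorphism over `M₀` fixes `a` and takes the representative of its coset
  -- to `z`; it carries `r⁻¹ a ∈ H` to `z⁻¹ a ∈ H`.
  have main : ∀ z : Γ, (∀ i, coord z i ∈ D) → SameType L (M₀ : Set N) (coord x) (coord z) →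
      z⁻¹ * a ∈ H := by
    intro z hzD hz
    have h1 := ht.sameType_elim hsub (x := coord (r q)) (y := coord z)
      (fun i => Or.inr (Or.inr ⟨(q, i), rfl⟩)) hzD ((hrP q).symm.trans hz)
    obtain ⟨σ, hσ, hσe⟩ := h1.exists_equiv hN hM₀
    rw [Sum.comp_elim] at hσe
    have hσ' : ∀ c ∈ C, σ c = c := fun c hc => hσ c (hC hc)
    obtain ⟨f, hf⟩ := hΓ.exists_hom σ hσ'
    have h2 : f (r q) = z := hΓ.injective ((hf _).trans (Sum.elim_eq_iff.1 hσe).1)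
    have h3 : f a = a := hΓ.injective ((hf _).trans (Sum.elim_eq_iff.1 hσe).2)
    have := hΓ.isInvariantOver_iff.1 hHinv σ f hσ' hf _ hra
    rwa [SetLike.mem_coe, map_mul, map_inv, h2, h3] at this
  have h1 := main x (fun i => Or.inr (Or.inl (Or.inl ⟨i, rfl⟩))) fun _ => Iff.rfl
  have h2 := main y (fun i => Or.inr (Or.inl (Or.inr ⟨i, rfl⟩))) hxy
  have := H.mul_mem h1 (H.inv_mem h2)
  simpa [mul_assoc] using this

/-- The normal core of an invariant subgroup of bounded index contains the quotients of elements
with the same type over a small elementary substructure. -/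
theorem IsInvariantGroup.inv_mul_mem_normalCore (hΓ : IsInvariantGroup L C coord)
    (hN : IsMonster L κ N) {H : Subgroup Γ} (hH : #(Γ ⧸ H) < κ)
    (hHinv : IsInvariantOver L C (coord '' (H : Set Γ)))
    {M₀ : L.ElementarySubstructure N} (hM₀ : #(M₀ : Set N) < κ) (hC : C ⊆ M₀) {x y : Γ}
    (hxy : SameType L (M₀ : Set N) (coord x) (coord y)) : x⁻¹ * y ∈ H.normalCore := by
  intro b
  -- In terms of `g` the goal is `g⁻¹ (x⁻¹ y) g ∈ H`. Below, `g` is replaced by a realization `a` of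
  -- a coheir of its type over `M₀`, `x`, `y`; the error `g⁻¹ a` lies in `H`.
  set g := b⁻¹ with hg
  obtain ⟨U, hU⟩ := exists_coheir M₀ (coord g)
  let D : Set N := M₀ ∪ (Set.range (coord x) ∪ Set.range (coord y))
  have hinf := hN.aleph0_le
  have hfin : ∀ z : ι → N, #(Set.range z) < κ := fun z =>
    (Set.finite_range z).lt_aleph0.trans_le hinf
  have hD : #D < κ := by
    refine (mk_union_le _ _).trans_lt (add_lt_of_lt hinf hM₀ ?_)
    exact (mk_union_le _ _).trans_lt (add_lt_of_lt hinf (hfin _) (hfin _))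
  obtain ⟨t, ht⟩ := hN.saturated.exists_realizesCoheir (fun d : M₀ => (d : N)) hD U
  have hsub : (M₀ : Set N) ⊆ D := Set.subset_union_left
  have hgt : SameType L (M₀ : Set N) (coord g) t := ht.sameType hsub hU
  obtain ⟨τ, hτ, hτg⟩ := hgt.exists_equiv hN hM₀
  obtain ⟨s, hs⟩ := hΓ.exists_hom τ fun c hc => hτ c (hC hc)
  have hst : coord (s g) = t := (hs g).trans hτg
  rw [← hst] at ht hgt
  set a := s g
  have hga : g⁻¹ * a ∈ H := hΓ.inv_mul_mem hN hH hHinv hM₀ hC hgt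
  obtain ⟨σ, hσ, hσe⟩ := (ht.sameType_elim hsub (x := coord x) (y := coord y)
    (fun i => Or.inr (Or.inl ⟨i, rfl⟩)) (fun i => Or.inr (Or.inr ⟨i, rfl⟩)) hxy).exists_equiv hN hM₀
  rw [Sum.comp_elim] at hσe
  obtain ⟨f, hf⟩ := hΓ.exists_hom σ fun c hc => hσ c (hC hc)
  have h2 : f x = y := hΓ.injective ((hf _).trans (Sum.elim_eq_iff.1 hσe).1)
  have h3 : f a = a := hΓ.injective ((hf _).trans (Sum.elim_eq_iff.1 hσe).2)
  -- The automorphism fixes `a` and takes `x` to `y`, so it takes `x a` to `y a`. Thus `a⁻¹ x⁻¹ y a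
  -- ∈ H`, and conjugating by `g⁻¹ a ∈ H` gives the goal.
  have h4 : SameType L (M₀ : Set N) (coord (x * a)) (coord (y * a)) := by
    have := sameType_comp_equiv σ hσ (coord (x * a))
    rwa [← hf, map_mul, h2, h3] at this
  have h5 := hΓ.inv_mul_mem hN hH hHinv hM₀ hC h4
  have h6 := H.mul_mem (H.mul_mem hga h5) (H.inv_mem hga)
  convert! h6 using 1
  rw [hg]
  group

/-- A subgroup that contains the quotients of elements with the same type over a small elementary
substructure has bounded index. -/
theorem mk_quotient_lt (hN : IsMonster L κ N) {D : Set N}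
    (hD : Cardinal.lift.{max u v} #D ≤ Cardinal.lift.{w'} (max ℵ₀ L.card)) {K : Subgroup Γ}
    (hK : ∀ x y : Γ, SameType L D (coord x) (coord y) → x⁻¹ * y ∈ K) : #(Γ ⧸ K) < κ := by
  rw [← lift_lt.{w', max u v}]
  refine lt_of_le_of_lt ?_ (hN.lift_mk_formula_lt hD (ι := ι))
  rw [← lift_id'.{w', max u v w'} #(Set (L.Formula (D ⊕ ι)))]
  rw [← lift_umax.{w', max u v}]
  -- A coset is sent to the type over `D` of its chosen representative.
  refine lift_mk_le_lift_mk_of_injective (f := fun q : Γ ⧸ K =>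
    {φ : L.Formula (D ⊕ ι) | φ.Realize (Sum.elim (fun d : D => (d : N)) (coord q.out))}) ?_
  intro p q e
  have : p.out⁻¹ * q.out ∈ K := hK _ _ fun φ => by
    exact Set.ext_iff.1 e φ
  rw [← p.out_eq', ← q.out_eq']
  exact QuotientGroup.eq.2 this

/-- One small model containing `C` works for every subgroup in the intersection, however many there
are. -/
theorem IsInvariantGroup.mk_quotient_component000_lt (hΓ : IsInvariantGroup L C coord)
    (hN : IsMonster L κ N) (hC : C.Finite) : #(Γ ⧸ component000 L κ C coord) < κ := by
  obtain ⟨M₀, hCM, hM₀⟩ := exists_small_elementarySubstructure L hC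
  refine mk_quotient_lt hN hM₀ (coord := coord) fun x y hxy => ?_
  simp only [component000, Subgroup.mem_sInf]
  exact fun H hH => hΓ.inv_mul_mem hN hH.1 hH.2 (hN.mk_lt hM₀) hCM hxy

/-- The normal core of the component is invariant of bounded index, so minimality puts the component
inside its own normal core. -/
theorem IsInvariantGroup.normal_component000 (hΓ : IsInvariantGroup L C coord)
    (hN : IsMonster L κ N) (hC : C.Finite) : (component000 L κ C coord).Normal := by
  obtain ⟨M₀, hCM, hM₀⟩ := exists_small_elementarySubstructure L hC
  have hb := hΓ.mk_quotient_component000_lt hN hC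
  have hinv := hΓ.isInvariantOver_component000 (κ := κ)
  have hle : component000 L κ C coord ≤ (component000 L κ C coord).normalCore := by
    refine component000_le ?_ ?_
    · exact mk_quotient_lt hN hM₀ (coord := coord) fun x y hxy =>
        hΓ.inv_mul_mem_normalCore hN hb hinv (hN.mk_lt hM₀) hCM hxy
    · rintro σ hσ _ ⟨x, hx, rfl⟩
      obtain ⟨s, hs⟩ := hΓ.exists_equiv σ hσ
      -- Conjugating `s x` by `b` is the image under `s` of conjugating `x` by `s.symm b`; this is
      -- why `s` must be bijective.
      refine ⟨s x, fun b => ?_, hs x⟩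
      have := hΓ.isInvariantOver_iff.1 hinv σ s hσ hs _ (hx (s.symm b))
      simpa using this
  rw [le_antisymm hle (Subgroup.normalCore_le _)]
  infer_instance

end BoundedIndex

/-! ### The second isomorphism theorem for subgroups of the extension. -/

section Extension

variable {G : Type*} {A : Type*} [Group G] [AddCommGroup A] [DistribMulAction G A]
  {h : TwoCocycle G A}

/-- The projection of the extension onto `G`. -/
def CocycleExtension.proj (h : TwoCocycle G A) : CocycleExtension h →* G where
  toFun := CocycleExtension.snd
  map_one' := rfl
  map_mul' _ _ := rfl

/-- The inclusion of `H ∩ A` into `H`. -/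
def interAHom (H : Subgroup (CocycleExtension h)) : Multiplicative (interA H) →* H where
  toFun a := ⟨⟨(a.toAdd : A), 1⟩, a.toAdd.2⟩
  map_one' := rfl
  map_mul' a b := Subtype.ext <| by
    simp [CocycleExtension.mul_def, h.map_one_left']

/-- If `K ≤ T` have the same image in `G`, then `T / K` is isomorphic to `(T ∩ A) / (K ∩ A)`. -/
theorem exists_quotient_equiv {K T : Subgroup (CocycleExtension h)} [(K.subgroupOf T).Normal]
    (hKT : K ≤ T) (hT : ∀ x ∈ T, ∃ k ∈ K, k.snd = x.snd) :
    ∃ Φ : (T ⧸ K.subgroupOf T) ≃*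
        Multiplicative (interA T ⧸ (interA K).addSubgroupOf (interA T)),
      ∀ (x : T) (a : interA T),
        Φ (QuotientGroup.mk x) = Multiplicative.ofAdd (QuotientAddGroup.mk a) ↔
          (x : CocycleExtension h)⁻¹ * ⟨a, 1⟩ ∈ K := by
  -- The map `T ∩ A → T / K`, with kernel `K ∩ A`. It is surjective: if `k ∈ K` has the same
  -- projection as `x`, then `x k⁻¹` lies in `T ∩ A` and in the coset of `x`.
  let F : interA T →+ Additive (T ⧸ K.subgroupOf T) :=
    MonoidHom.toAdditiveRight ((QuotientGroup.mk' (K.subgroupOf T)).comp (interAHom T))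
  have hF : ∀ a : interA T, F a =
      Additive.ofMul (QuotientGroup.mk (interAHom T (Multiplicative.ofAdd a))) := fun _ => rfl
  have hker : F.ker = (interA K).addSubgroupOf (interA T) := by
    ext a
    rw [AddMonoidHom.mem_ker, hF, ofMul_eq_zero, QuotientGroup.eq_one_iff]
    rfl
  have hsurj : Function.Surjective F := by
    intro q
    obtain ⟨x, hx⟩ := QuotientGroup.mk_surjective q.toMul
    obtain ⟨k, hk, hkx⟩ := hT x x.2
    have h1 : ((x : CocycleExtension h) * k⁻¹).snd = 1 := by
      simp [CocycleExtension.mul_def, CocycleExtension.inv_def, hkx]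
    have h2 : (⟨((x : CocycleExtension h) * k⁻¹).fst, 1⟩ : CocycleExtension h) = x * k⁻¹ :=
      CocycleExtension.ext rfl h1.symm
    have h3 : (⟨((x : CocycleExtension h) * k⁻¹).fst, 1⟩ : CocycleExtension h) ∈ T := by
      rw [h2]
      exact T.mul_mem x.2 (T.inv_mem (hKT hk))
    refine ⟨⟨_, h3⟩, ?_⟩
    rw [hF, ← ofMul_toMul q, ← hx]
    refine congrArg _ (QuotientGroup.eq.2 ?_)
    rw [Subgroup.mem_subgroupOf]
    change (⟨((x : CocycleExtension h) * k⁻¹).fst, 1⟩ : CocycleExtension h)⁻¹ * x ∈ K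
    rw [h2]
    simpa using hk
  let E := (QuotientAddGroup.quotientAddEquivOfEq hker.symm).trans
    (QuotientAddGroup.quotientKerEquivOfSurjective F hsurj)
  have hE : ∀ a : interA T, E (QuotientAddGroup.mk a) = F a := fun _ => rfl
  -- `Φ` inverts the map induced by `F`, so `x` goes to the class of `a` exactly when `a` and `x`
  -- share a coset of `K`.
  refine ⟨(AddEquiv.toMultiplicativeLeft E).symm, fun x a => ?_⟩
  rw [MulEquiv.symm_apply_eq]
  change _ = (E (QuotientAddGroup.mk a)).toMul ↔ _
  rw [hE, hF, toMul_ofMul, QuotientGroup.eq, Subgroup.mem_subgroupOf]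
  rfl

end Extension

/-! ### Automorphisms acting on interpretations of definable sets and functions. -/

section Interpretation

open FirstOrder FirstOrder.Language

variable {L : FirstOrder.Language.{u, v}} {M : Type w} {N : Type w'} [L.Structure M] [L.Structure N]
  {j : M ↪ₑ[L] N} {B : Set M}

/-- The definition of `star` admits formulas with parameters from all of `M`. Keeping the parameters
in `B` is what lets automorphisms fixing only `j '' B` preserve the interpretation. -/
theorem exists_formula_star {τ : Type*} [Finite τ] {X : Set (τ → M)} (hX : B.Definable L X) :
    ∃ φ : L.Formula (B ⊕ τ), ∀ v : τ → N,
      v ∈ star j X ↔ φ.Realize (Sum.elim (fun b : B => j b) v) := by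
  obtain ⟨φ, hφ⟩ := Set.definable_iff_exists_formula_sum.1 hX
  refine ⟨φ, fun v => ?_⟩
  rw [mem_star_iff (φ := φ.relabel (Sum.map (fun c : B => (c : M)) id)), Formula.realize_relabel,
    Sum.elim_comp_map]
  · rfl
  · intro t
    rw [Formula.realize_relabel, hφ, Sum.elim_comp_map]
    rfl

theorem definable_star {τ : Type*} [Finite τ] {X : Set (τ → M)} (hX : B.Definable L X) :
    (j '' B).Definable L (star j X) := by
  obtain ⟨φ, hφ⟩ := exists_formula_star (j := j) hX
  refine Set.definable_iff_exists_formula_sum.2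
    ⟨φ.relabel (Sum.map (fun b : B => (⟨j b, b, b.2, rfl⟩ : j '' B)) id), ?_⟩
  ext v
  rw [hφ, Set.mem_ofPred_eq, Formula.realize_relabel, Sum.elim_comp_map]
  rfl

theorem comp_mem_star {τ : Type*} [Finite τ] {X : Set (τ → M)} (hX : B.Definable L X)
    {σ : N ≃[L] N} (hσ : ∀ c ∈ j '' B, σ c = c) {v : τ → N} (hv : v ∈ star j X) :
    σ ∘ v ∈ star j X := by
  obtain ⟨φ, hφ⟩ := exists_formula_star (j := j) hX
  rw [hφ] at hv ⊢
  rw [← StrongHomClass.realize_formula σ φ, Sum.comp_elim] at hv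
  have : (σ : N → N) ∘ (fun b : B => j b) = fun b : B => j b :=
    funext fun b => hσ _ ⟨b, b.2, rfl⟩
  rwa [this] at hv

theorem comp_tuple₃ {K K' α β γ : Type*} (f : K → K') (x : α → K) (y : β → K) (z : γ → K) :
    f ∘ tuple₃ x y z = tuple₃ (f ∘ x) (f ∘ y) (f ∘ z) := by
  simp only [tuple₃, Sum.comp_elim]

/-- Automorphisms over the parameters commute with interpretations of definable functions. -/
theorem comp_starMap {α β γ : Type*} [Finite α] [Finite β] [Finite γ]
    {C₁ C₂ C₃ : Set M} {X : Set (α → M)} {Y : Set (β → M)} {Z : Set (γ → M)} (f : X → Y → Z)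
    (hX : C₁.Definable L X) (hY : C₂.Definable L Y) (hZ : C₃.Definable L Z)
    (hf : B.Definable L (graph₂ f)) {σ : N ≃[L] N} (hσ : ∀ c ∈ j '' B, σ c = c)
    {x x' : star j X} {y y' : star j Y} (hx : x'.1 = σ ∘ x.1) (hy : y'.1 = σ ∘ y.1) :
    (starMap j f hX hY hZ hf x' y').1 = σ ∘ (starMap j f hX hY hZ hf x y).1 := by
  have h1 := comp_mem_star hf hσ (starMap_spec j f hX hY hZ hf x y)
  rw [comp_tuple₃, ← hx, ← hy] at h1
  exact star_unique hf (starMap_spec j f hX hY hZ hf x' y') h1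

end Interpretation

/-! ### The components of the extension and their projections to `G*`. -/

section Situation

open FirstOrder FirstOrder.Language Cardinal

namespace DefinableExtension

variable {L : FirstOrder.Language.{u, v}} {M : Type w} [L.Structure M]
  {B : Set M} {m n : ℕ} {G : Set (Fin m → M)} {A : Set (Fin n → M)} [Group G]
  [AddCommGroup A] [DistribMulAction G A] {h : TwoCocycle G A}
  {N : Type w'} [L.Structure N]
  (S : DefinableExtension L B G A h) (j : M ↪ₑ[L] N) (κ : Cardinal.{w'})

/-- The map of `G*` induced by an automorphism. -/
def mapG {σ : N ≃[L] N} (hσ : ∀ c ∈ j '' B, σ c = c) (x : S.GStar j) : S.GStar j :=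
  ⟨σ ∘ x.1, comp_mem_star (S.definable_G.mono (Set.empty_subset B)) hσ x.2⟩

/-- The map of `A*` induced by an automorphism. -/
def mapA {σ : N ≃[L] N} (hσ : ∀ c ∈ j '' B, σ c = c) (a : S.AStar j) : S.AStar j :=
  ⟨σ ∘ a.1, comp_mem_star (S.definable_A.mono (Set.empty_subset B)) hσ a.2⟩

variable {σ : N ≃[L] N} (hσ : ∀ c ∈ j '' B, σ c = c)

/-- Lets `comp_starMap` be applied to the operations definable without parameters; among the
structure maps only the cocycle requires `σ` to fix `B`. -/
theorem eq_of_mem_image_empty : ∀ c ∈ j '' (∅ : Set M), σ c = c := by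
  rintro _ ⟨_, h, _⟩
  exact h.elim

theorem mapG_mul (x y : S.GStar j) : S.mapG j hσ (x * y) = S.mapG j hσ x * S.mapG j hσ y :=
  Subtype.ext (comp_starMap (fun g₁ g₂ : G => g₁ * g₂) _ _ _ S.definable_mul
    (eq_of_mem_image_empty j) rfl rfl).symm

theorem mapA_add (x y : S.AStar j) : S.mapA j hσ (x + y) = S.mapA j hσ x + S.mapA j hσ y :=
  Subtype.ext (comp_starMap (fun a₁ a₂ : A => a₁ + a₂) _ _ _ S.definable_add
    (eq_of_mem_image_empty j) rfl rfl).symm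

theorem mapA_smul (x : S.GStar j) (a : S.AStar j) :
    S.mapA j hσ (x • a) = S.mapG j hσ x • S.mapA j hσ a :=
  Subtype.ext (comp_starMap (fun (g : G) (a : A) => g • a) _ _ _ S.definable_smul
    (eq_of_mem_image_empty j) rfl rfl).symm

theorem mapA_hFun (x y : S.GStar j) :
    S.mapA j hσ (S.hFun j x y) = S.hFun j (S.mapG j hσ x) (S.mapG j hσ y) :=
  Subtype.ext (comp_starMap h.toFun _ _ _ S.definable_h hσ rfl rfl).symm

/-- The endomorphism of the interpretation of the extension induced by an automorphism. -/
def mapExt (x : S.ExtStar j) : S.ExtStar j := ⟨S.mapA j hσ x.fst, S.mapG j hσ x.snd⟩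

theorem mapExt_mul (x y : S.ExtStar j) :
    S.mapExt j hσ (x * y) = S.mapExt j hσ x * S.mapExt j hσ y := by
  refine CocycleExtension.ext ?_ (S.mapG_mul j hσ _ _)
  change S.mapA j hσ (x.fst + x.snd • y.fst + S.hFun j x.snd y.snd) =
    S.mapA j hσ x.fst + S.mapG j hσ x.snd • S.mapA j hσ y.fst +
      S.hFun j (S.mapG j hσ x.snd) (S.mapG j hσ y.snd)
  rw [mapA_add, mapA_add, mapA_smul, mapA_hFun]

theorem coordExt_mapExt (x : S.ExtStar j) :
    S.coordExt j (S.mapExt j hσ x) = σ ∘ S.coordExt j x :=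
  (Sum.comp_elim σ (S.coordA j x.fst) (S.coordG j x.snd)).symm

theorem coordExt_injective : Function.Injective (S.coordExt j) := by
  intro x y e
  obtain ⟨h1, h2⟩ := Sum.elim_eq_iff.1 e
  exact CocycleExtension.ext (S.coordA_injective j h1) (S.coordG_injective j h2)

theorem isInvariantGroup_coordExt : IsInvariantGroup L (j '' B) (S.coordExt j) where
  injective := S.coordExt_injective j
  exists_hom _ hσ := ⟨MonoidHom.mk' (S.mapExt j hσ) (S.mapExt_mul j hσ), S.coordExt_mapExt j hσ⟩

theorem finite_image_B (S : DefinableExtension L B G A h) : (j '' B).Finite := S.finite_B.image j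

theorem coordExt_image_comap (H : Subgroup (S.GStar j)) :
    S.coordExt j '' (H.comap (CocycleExtension.proj (S.hStar j)) : Set (S.ExtStar j)) =
      {t | t ∘ Sum.inl ∈ star j A} ∩ {t | t ∘ Sum.inr ∈ S.coordG j '' (H : Set (S.GStar j))} := by
  ext t
  constructor
  · rintro ⟨x, hx, rfl⟩
    exact ⟨x.fst.2, x.snd, hx, rfl⟩
  · rintro ⟨h1, g, hg, e⟩
    refine ⟨⟨⟨_, h1⟩, g⟩, hg, ?_⟩
    change Sum.elim (t ∘ Sum.inl) (S.coordG j g) = t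
    rw [e, Sum.elim_comp_inl_inr]

/-- The preimage is `A* × H`: the definable condition on the `A`-coordinates joins the conditions
defining `H` on the others. -/
theorem isTypeDefinableOver_comap {H : Subgroup (S.GStar j)}
    (hH : IsTypeDefinableOver L (j '' B) (S.coordG j '' (H : Set (S.GStar j)))) :
    IsTypeDefinableOver L (j '' B)
      (S.coordExt j '' (H.comap (CocycleExtension.proj (S.hStar j)) : Set (S.ExtStar j))) := by
  obtain ⟨F, hF, e⟩ := hH
  refine ⟨insert {t | t ∘ Sum.inl ∈ star j A} ((fun D => {t | t ∘ Sum.inr ∈ D}) '' F), ?_, ?_⟩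
  · rintro D (rfl | ⟨D, hD, rfl⟩)
    · exact (definable_star (S.definable_A.mono (Set.empty_subset B))).preimage_comp Sum.inl
    · exact (hF D hD).preimage_comp Sum.inr
  · rw [S.coordExt_image_comap, e, Set.sInter_insert, Set.sInter_image]
    congr 1
    ext t
    simp

/-- The preimage of each `H` defining `G00` is one of the subgroups defining `Ext00`: it is
type-definable, and its cosets inject into those of `H`. -/
theorem snd_mem_G00 {x : S.ExtStar j} (hx : x ∈ S.Ext00 j κ) : x.snd ∈ S.G00 j κ := by
  refine Subgroup.mem_sInf.2 fun H hH => ?_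
  refine Subgroup.mem_sInf.1 hx (H.comap (CocycleExtension.proj (S.hStar j)))
    ⟨lt_of_le_of_lt ?_ hH.1, S.isTypeDefinableOver_comap j hH.2⟩
  refine mk_le_of_injective (f := fun q => (QuotientGroup.mk q.out.snd : S.GStar j ⧸ H)) ?_
  intro p q e
  rw [← p.out_eq', ← q.out_eq']
  have h1 : p.out.snd⁻¹ * q.out.snd ∈ H := QuotientGroup.eq.1 e
  exact QuotientGroup.eq.2 h1

variable {κ}

/-- The image of `Ext000` in `G*` is invariant, and it has bounded index because `Ext000` does;
hence it contains the smallest such subgroup. -/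
theorem exists_mem_Ext000 (hN : IsMonster L κ N) {g : S.GStar j} (hg : g ∈ S.G000 j κ) :
    ∃ k ∈ S.Ext000 j κ, k.snd = g := by
  have hle : S.G000 j κ ≤ (S.Ext000 j κ).map (CocycleExtension.proj (S.hStar j)) := by
    refine component000_le ?_ ?_
    · refine lt_of_le_of_lt ?_ ((S.isInvariantGroup_coordExt j).mk_quotient_component000_lt hN
        (S.finite_image_B j))
      -- Cosets of the image are lifted by the section `g ↦ (0, g)`. It need not be a homomorphism,
      -- since injectivity is checked after projecting back.
      refine mk_le_of_injective (f := fun q =>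
        QuotientGroup.mk (⟨0, q.out⟩ : S.ExtStar j)) ?_
      intro p q e
      rw [← p.out_eq', ← q.out_eq']
      exact QuotientGroup.eq.2 ⟨_, QuotientGroup.eq.1 e, rfl⟩
    · rintro σ hσ _ ⟨_, ⟨k, hk, rfl⟩, rfl⟩
      exact ⟨_, ⟨S.mapExt j hσ k, (S.isInvariantGroup_coordExt j).isInvariantOver_iff.1
        (S.isInvariantGroup_coordExt j).isInvariantOver_component000 σ _ hσ
          (S.coordExt_mapExt j hσ) k hk, rfl⟩, rfl⟩
  exact hle hg

end DefinableExtension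

end Situation

end GroupExtComponents

/-! ### The isomorphism and its invariance. -/

theorem mainTheorem7 {L : FirstOrder.Language.{u, v}} {M : Type w} [L.Structure M]
    {B : Set M} {m n : ℕ} {G : Set (Fin m → M)} {A : Set (Fin n → M)}
    [Group G] [AddCommGroup A] [DistribMulAction G A] {h : GroupExtComponents.TwoCocycle G A}
    (S : GroupExtComponents.DefinableExtension L B G A h)
    {N : Type w'} [L.Structure N] (j : FirstOrder.Language.ElementaryEmbedding L M N)
    (κ : Cardinal.{w'}) (hN : GroupExtComponents.IsMonster L κ N)
    (hG : S.G000 j κ = S.G00 j κ) :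
    ∃ _ : ((S.Ext000 j κ).subgroupOf (S.Ext00 j κ)).Normal,
      (∃ Φ : (S.Ext00 j κ ⧸ (S.Ext000 j κ).subgroupOf (S.Ext00 j κ)) ≃*
          Multiplicative (GroupExtComponents.interA (S.Ext00 j κ) ⧸
            (GroupExtComponents.interA (S.Ext000 j κ)).addSubgroupOf
              (GroupExtComponents.interA (S.Ext00 j κ))),
        GroupExtComponents.IsInvariantOver L (j '' B)
          {t | ∃ (x : S.Ext00 j κ) (a : GroupExtComponents.interA (S.Ext00 j κ)),
            t = Sum.elim (S.coordExt j x) (S.coordA j a) ∧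
            Φ (QuotientGroup.mk x) = Multiplicative.ofAdd (QuotientAddGroup.mk a)}) ∧
      ∀ x y : S.Ext00 j κ ⧸ (S.Ext000 j κ).subgroupOf (S.Ext00 j κ), x * y = y * x := by
  have hinv := S.isInvariantGroup_coordExt j
  have hnormal : (S.Ext000 j κ).Normal := hinv.normal_component000 hN (S.finite_image_B j)
  have hle : S.Ext000 j κ ≤ S.Ext00 j κ := GroupExtComponents.component000_le_component00
  -- The equality of the components of `G*` enters here: the projection of `x` lies in `G00 = G000`,
  -- hence lifts to `Ext000`.
  obtain ⟨Φ, hΦ⟩ := GroupExtComponents.exists_quotient_equiv hle fun x hx =>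
    S.exists_mem_Ext000 j hN (hG ▸ S.snd_mem_G00 j κ hx)
  refine ⟨inferInstance, ⟨Φ, ?_⟩, fun x y => Φ.injective (by rw [map_mul, map_mul, mul_comm])⟩
  rintro σ hσ _ ⟨x, a, rfl, hxa⟩
  have h000 := hinv.isInvariantOver_iff.1 (hinv.isInvariantOver_component000 (κ := κ)) σ _ hσ
    (S.coordExt_mapExt j hσ)
  have h00 : ∀ y ∈ S.Ext00 j κ, S.mapExt j hσ y ∈ S.Ext00 j κ := by
    intro y hy
    refine Subgroup.mem_sInf.2 fun H hH => ?_
    exact hinv.isInvariantOver_iff.1 hH.2.isInvariantOver σ _ hσ (S.coordExt_mapExt j hσ) y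
      (Subgroup.mem_sInf.1 hy H hH)
  let f := MonoidHom.mk' (S.mapExt j hσ) (S.mapExt_mul j hσ)
  have hfA : ∀ b : S.AStar j, f ⟨b, 1⟩ = ⟨S.mapA j hσ b, 1⟩ := fun b =>
    GroupExtComponents.CocycleExtension.ext rfl
      (map_one (MonoidHom.mk' (S.mapG j hσ) (S.mapG_mul j hσ)))
  refine ⟨⟨f x, h00 x x.2⟩, ⟨S.mapA j hσ a, ?_⟩, ?_, ?_⟩
  · have := h00 _ a.2
    change f _ ∈ _ at this
    rwa [hfA] at this
  · rw [Sum.comp_elim, ← S.coordExt_mapExt j hσ]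
    rfl
  -- The relation has become `x⁻¹ a ∈ Ext000`, which the induced endomorphism `f` preserves.
  · rw [hΦ] at hxa ⊢
    have := h000 _ hxa
    change f (_ * _) ∈ _ at this
    rw [map_mul, map_inv, hfA] at this
    exact this
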